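/- For $e\in[0,1)$ and $\beta\in\mathbb R$ let $$A(\beta,e)=-\frac{d^2}{dt^2}-1+\frac{\beta}{1+e\cos t}$$ be the operator on $L^2([0,2\pi],\mathbb C)$ with domain $$E=\overline D(-1,2\pi)=\{y\in W^{2,2}([0,2\pi],\mathbb C)\mid y(2\pi)=-y(0),\ \dot y(2\pi)=-\dot y(0)\}.$$ Let $\gamma_{\beta,e}$ be the real $2\times2$ fundamental solution of $\dot\gamma=J\,\mathrm{diag}\bigl(1,\,1-\tfrac{\beta}{1+e\cos t}\bigr)\gamma$, $\gamma(0)=I_2$, where $J=\begin{pmatrix}0&-1\\1&0\end{pmatrix}$, and let $\nu_{-1}(M)=\dim_{\mathbb C}\ker_{\mathbb C}(M+I_2)$. Let $(g z)(t)=-z(2\pi-t)$ on $L^2([0,2\pi],\mathbb C)$, and put $E_1=\{z\in E\mid gz=-z\}$ and $E_2=\{z\in E\mid gz=z\}$, i.e. the functions in $E$ whose extension by $z(t+2\pi)=-z(t)$ is odd, respectively even. A pair of functions $\beta_1(\cdot,-1),\beta_2(\cdot,-1)$ on $[0,1)$ is called a pair of $-1$-degeneracy curves if both are real analytic with values in $(0,1)$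 and, for every $e\in[0,1)$, they list with multiplicity all $\beta\in[0,1]$ at which $\gamma_{\beta,e}(2\pi)$ is $-1$-degenerate, i.e. $\nu_{-1}(\gamma_{\beta,e}(2\pi))=\#\{i\in\{1,2\}\mid\beta_i(e,-1)=\beta\}$ for all $\beta\in[0,1]$. Then the following hold. 1. $g$ maps $E$ into $E$ and $A(\beta,e)g=gA(\beta,e)$ on $E$ for all $\beta\in\mathbb R$, $e\in[0,1)$; moreover $E=E_1\oplus E_2$. 2. A pair of $-1$-degeneracy curves exists. For every such pair, after possibly exchanging the two functions (once, for all $e$), $\beta_i(\cdot,-1)$ is exactly the degeneracy curve of $A(\beta,e)|_{E_i}$ for $i=1$ and $i=2$: for all $(\beta,e)\in[0,1]\times[0,1)$, $$\ker\bigl(A(\beta,e)|_{E_i}\bigr)\neq\{0\}\iff\beta=\beta_i(e,-1).$$ -/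

import Mathlib

open MeasureTheory Set

noncomputable section

namespace SturmLiouville

/-- The coefficient `β / (1 + e cos t)`, for an eccentricity `e ∈ [0,1)`. -/
def potential (β : ℝ) (e : Ico (0 : ℝ) 1) (t : ℝ) : ℝ := β / (1 + e * Real.cos t)

theorem one_add_pos (e : Ico (0 : ℝ) 1) (t : ℝ) : 1 - (e : ℝ) ≤ 1 + e * Real.cos t := by
  nlinarith [Real.neg_one_le_cos t, e.2.1]

theorem potential_contDiff (β : ℝ) (e : Ico (0 : ℝ) 1) {n : WithTop ℕ∞} :
    ContDiff ℝ n (potential β e) := by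
  unfold potential
  refine contDiff_const.div (contDiff_const.add (contDiff_const.mul Real.contDiff_cos)) fun t => ?_
  have := one_add_pos e t
  have := e.2.2
  linarith

theorem potential_abs_le (β : ℝ) (e : Ico (0 : ℝ) 1) (t : ℝ) :
    |potential β e t| ≤ |β| / (1 - e) := by
  have h1 := one_add_pos e t
  have h2 : 0 < 1 - (e : ℝ) := by linarith [e.2.2]
  unfold potential
  rw [abs_div, abs_of_pos (lt_of_lt_of_le h2 h1)]
  gcongr

/-- The standard symplectic matrix `J₂`. -/
def J : Matrix (Fin 2) (Fin 2) ℝ := !![0, -1; 1, 0]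
/-- The coefficient matrix `B(t) = diag(1, 1 - β / (1 + e cos t))`. -/
def B (β : ℝ) (e : Ico (0 : ℝ) 1) (t : ℝ) : Matrix (Fin 2) (Fin 2) ℝ :=
  !![1, 0; 0, 1 - potential β e t]

/-- `γ` solves `γ' = J B γ`, `γ(0) = I` (derivatives are taken entrywise). -/
def IsFundamentalSolution (β : ℝ) (e : Ico (0 : ℝ) 1) (γ : ℝ → Matrix (Fin 2) (Fin 2) ℝ) : Prop :=
  γ 0 = 1 ∧ ∀ t i j, HasDerivAt (fun s => γ s i j) ((J * B β e t * γ t) i j) t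

theorem local_sol (β : ℝ) (e : Ico (0 : ℝ) 1) : ∃ ε > (0 : ℝ), ∀ (t₀ : ℝ) (x : ℝ × ℝ),
    ∃ α : ℝ → ℝ × ℝ, α 0 = x ∧ ∀ t ∈ Ioo (-ε) ε,
      HasDerivAt α (-((1 - potential β e (t₀ + t)) * (α t).2), (α t).1) t := by
  obtain ⟨K, hK⟩ : ∃ K : NNReal, ∀ t, |1 - potential β e t| ≤ K ∧ 1 ≤ (K : ℝ) := by
    have hn : 0 ≤ |β| / (1 - (e : ℝ)) := div_nonneg (abs_nonneg _) (by linarith [e.2.2])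
    refine ⟨Real.toNNReal (1 + |β| / (1 - e)), fun t => ⟨?_, ?_⟩⟩ <;>
      rw [Real.coe_toNNReal _ (by positivity)]
    · have := potential_abs_le β e t
      have := abs_sub (1 : ℝ) (potential β e t)
      rw [abs_one] at this
      linarith
    · linarith
  have hK1 := (hK 0).2
  refine ⟨1 / (2 * K), by positivity, fun t₀ x => ?_⟩
  set ε : ℝ := 1 / (2 * K) with hε
  have hεp : 0 < ε := by positivity
  have hlin : ∀ (t : ℝ) (y : ℝ × ℝ), ‖((-((1 - potential β e (t₀ + t)) * y.2), y.1) : ℝ × ℝ)‖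
      ≤ K * ‖y‖ := by
    intro t y
    have h1 : |y.1| ≤ ‖y‖ := norm_fst_le y
    have h2 : |y.2| ≤ ‖y‖ := norm_snd_le y
    rw [Prod.norm_def]
    refine max_le ?_ ?_
    · simp only [norm_neg, norm_mul, Real.norm_eq_abs]
      exact mul_le_mul (hK _).1 h2 (abs_nonneg _) K.2
    · simp only [Real.norm_eq_abs]
      nlinarith [norm_nonneg y]
  have hPL : IsPicardLindelof (fun t (y : ℝ × ℝ) => ((-((1 - potential β e (t₀ + t)) * y.2), y.1) : ℝ × ℝ))
      (tmin := -ε) (tmax := ε) ⟨0, by constructor <;> linarith⟩ x (‖x‖₊ + 1) 0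
      (K * (2 * ‖x‖₊ + 1)) K := by
    constructor
    · intro t _
      refine LipschitzWith.lipschitzOnWith (LipschitzWith.of_dist_le_mul fun y z => ?_)
      rw [dist_eq_norm, dist_eq_norm]
      convert! hlin t (y - z) using 2
      ext <;> simp
      ring
    · intro y _
      have := (potential_contDiff β e (n := 0)).continuous
      fun_prop
    · intro t _ y hy
      refine (hlin t y).trans ?_
      push_cast
      gcongr
      rw [mem_closedBall_iff_norm] at hy
      have := norm_sub_norm_le y x
      push_cast at hy
      linarith
    · push_cast
      simp only [sub_zero, zero_sub, neg_neg, max_self]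
      have : K * (2 * ‖x‖ + 1) * ε = ‖x‖ + 1 / 2 := by
        rw [hε]; field_simp
      rw [this]; linarith
  obtain ⟨α, h0, h1⟩ := hPL.exists_eq_forall_mem_Icc_hasDerivWithinAt₀
  exact ⟨α, h0, fun t ht => (h1 t (Ioo_subset_Icc_self ht)).hasDerivAt (Icc_mem_nhds ht.1 ht.2)⟩

open scoped Manifold ContDiff in
theorem global_sol (β : ℝ) (e : Ico (0 : ℝ) 1) (x : ℝ × ℝ) : ∃ α : ℝ → ℝ × ℝ, α 0 = x ∧
    ∀ t, HasDerivAt α (-((1 - potential β e t) * (α t).2), (α t).1) t := by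
  obtain ⟨ε, hε, h⟩ := local_sol β e
  let v : (y : ℝ × ℝ × ℝ) → TangentSpace 𝓘(ℝ, ℝ × ℝ × ℝ) y :=
    fun y => ((1, -((1 - potential β e y.1) * y.2.2), y.2.1) : ℝ × ℝ × ℝ)
  have hv : ContMDiff 𝓘(ℝ, ℝ × ℝ × ℝ) 𝓘(ℝ, ℝ × ℝ × ℝ).tangent 1
      (fun y ↦ (⟨y, v y⟩ : TangentBundle 𝓘(ℝ, ℝ × ℝ × ℝ) (ℝ × ℝ × ℝ))) := by
    rw [contMDiff_vectorSpace_iff_contDiff]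
    have := (potential_contDiff β e (n := 1))
    show ContDiff ℝ 1 (fun y : ℝ × ℝ × ℝ => ((1, -((1 - potential β e y.1) * y.2.2), y.2.1) : ℝ × ℝ × ℝ))
    fun_prop
  obtain ⟨Γ, hΓ0, hΓ⟩ := exists_isMIntegralCurve_of_isMIntegralCurveOn hv hε (by
    intro y
    obtain ⟨α, h0, h1⟩ := h y.1 y.2
    refine ⟨fun t => (y.1 + t, α t), by simp [h0], fun t ht => ?_⟩
    have h2 : HasDerivAt (fun t => (y.1 + t, α t)) (v (y.1 + t, α t)) t :=
      ((hasDerivAt_id t).const_add y.1).prodMk (h1 t ht)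
    exact (hasMFDerivAt_iff_hasFDerivAt.2 h2.hasFDerivAt).hasMFDerivWithinAt) ((0, x) : ℝ × ℝ × ℝ)
  have hd : ∀ t, HasDerivAt Γ (v (Γ t)) t := fun t => by
    have := hasMFDerivAt_iff_hasFDerivAt.1 (hΓ t)
    convert! this.hasDerivAt using 1
    exact (one_smul ℝ (v (Γ t))).symm
  have h1 : ∀ t, (Γ t).1 = t := by
    have hz : ∀ t, HasDerivAt (fun t => (Γ t).1 - t) 0 t := fun t => by
      have : HasDerivAt (fun t => (Γ t).1) 1 t := (hd t).fst
      simpa using! this.sub (hasDerivAt_id t)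
    intro t
    have := is_const_of_deriv_eq_zero (fun t => (hz t).differentiableAt) (fun t => (hz t).deriv) t 0
    simp only [hΓ0] at this
    linarith
  refine ⟨fun t => (Γ t).2, by simp [hΓ0], fun t => ?_⟩
  have h2 : HasDerivAt (fun t => (Γ t).2) (-((1 - potential β e (Γ t).1) * (Γ t).2.2), (Γ t).2.1) t :=
    (hd t).snd
  rwa [h1 t] at h2

theorem exists_fundamentalSolution (β : ℝ) (e : Ico (0 : ℝ) 1) :
    ∃ γ, IsFundamentalSolution β e γ := by
  obtain ⟨a, ha0, ha⟩ := global_sol β e (1, 0)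
  obtain ⟨b, hb0, hb⟩ := global_sol β e (0, 1)
  refine ⟨fun t => !![(a t).1, (b t).1; (a t).2, (b t).2], ?_, fun t i j => ?_⟩
  · simp [ha0, hb0, Matrix.one_fin_two]
  · have e1 : HasDerivAt (fun s => (a s).1) _ t := (ha t).fst
    have e2 : HasDerivAt (fun s => (a s).2) _ t := (ha t).snd
    have e3 : HasDerivAt (fun s => (b s).1) _ t := (hb t).fst
    have e4 : HasDerivAt (fun s => (b s).2) _ t := (hb t).snd
    fin_cases i <;> fin_cases j
    · convert! e1 using 1
      simp [J, B]
      ring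
    · convert! e3 using 1
      simp [J, B]
      ring
    · convert! e2 using 1
      simp [J, B]
    · convert! e4 using 1
      simp [J, B]

/-- The fundamental solution `γ_{β,e}` of `z' = J B_{β,e}(t) z`. -/
def fundamentalSolution (β : ℝ) (e : Ico (0 : ℝ) 1) : ℝ → Matrix (Fin 2) (Fin 2) ℝ :=
  (exists_fundamentalSolution β e).choose

theorem fundamentalSolution_spec (β : ℝ) (e : Ico (0 : ℝ) 1) :
    IsFundamentalSolution β e (fundamentalSolution β e) :=
  (exists_fundamentalSolution β e).choose_spec

/-- `ν_ω(M) = dim_ℂ ker_ℂ (M - ω I)`. -/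
def nullity (ω : ℂ) (M : Matrix (Fin 2) (Fin 2) ℝ) : ℕ :=
  Module.finrank ℂ (LinearMap.ker
    (Matrix.toLin' (M.map (algebraMap ℝ ℂ) - ω • (1 : Matrix (Fin 2) (Fin 2) ℂ))))

open Classical in
/-- `(β₁(e), e)` and `(β₂(e), e)`, `e ∈ [0,1)`, are the two `ω`-degeneracy curves of
`γ_{β,e}(2π)`: both functions are real analytic on `[0,1)` with values in `(0,1)`, and for each
`e` they list, with multiplicity, all `β ∈ [0,1]` at which `γ_{β,e}` is `ω`-degenerate. -/
structure AreDegeneracyCurves (ω : ℂ) (β₁ β₂ : ℝ → ℝ) : Prop where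
  analytic₁ : AnalyticOn ℝ β₁ (Ico 0 1)
  analytic₂ : AnalyticOn ℝ β₂ (Ico 0 1)
  mem₁ : ∀ e ∈ Ico (0 : ℝ) 1, β₁ e ∈ Ioo (0 : ℝ) 1
  mem₂ : ∀ e ∈ Ico (0 : ℝ) 1, β₂ e ∈ Ioo (0 : ℝ) 1
  nullity_eq : ∀ (e : Ico (0 : ℝ) 1), ∀ β ∈ Icc (0 : ℝ) 1,
    nullity ω (fundamentalSolution β e (2 * Real.pi)) =
      (if β = β₁ e then 1 else 0) + (if β = β₂ e then 1 else 0)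

/-- Lebesgue measure on `[0, 2π]`. -/
abbrev intervalMeasure : Measure ℝ := volume.restrict (Icc 0 (2 * Real.pi))

/-- The Hilbert space `L²([0, 2π], ℂ)`. -/
abbrev L2 : Type := Lp ℂ 2 intervalMeasure

/-- `y` belongs to `W^{2,2}([0, 2π], ℂ)`, with continuously differentiable representative `u`,
derivative `v = u'` (absolutely continuous on `[0, 2π]`) and second weak derivative `w ∈ L²`. -/
structure IsW22 (y : L2) (u v : ℝ → ℂ) (w : L2) : Prop where
  ae_eq : y =ᵐ[intervalMeasure] u
  eq_integral : ∀ t ∈ Icc 0 (2 * Real.pi), u t = u 0 + ∫ s in (0 : ℝ)..t, v s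
  deriv_eq_integral : ∀ t ∈ Icc 0 (2 * Real.pi), v t = v 0 + ∫ s in (0 : ℝ)..t, w s

theorem integral_congr {f g : ℝ → ℂ} (h : f =ᵐ[intervalMeasure] g) {t : ℝ} (ht : t ∈ Icc 0 (2 * Real.pi)) :
    ∫ s in (0 : ℝ)..t, f s = ∫ s in (0 : ℝ)..t, g s := by
  refine intervalIntegral.integral_congr_ae ?_
  have h' := (ae_restrict_iff' measurableSet_Icc).1 h
  filter_upwards [h'] with s hs hs'
  rw [uIoc_of_le ht.1] at hs'
  exact hs ⟨hs'.1.le, hs'.2.trans ht.2⟩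

theorem intervalIntegrable_of_integrable {f : ℝ → ℂ} (h : Integrable f intervalMeasure) {t : ℝ}
    (ht : t ∈ Icc 0 (2 * Real.pi)) : IntervalIntegrable f volume 0 t :=
  (intervalIntegrable_iff_integrableOn_Icc_of_le ht.1).2
    (IntegrableOn.mono_set h (Icc_subset_Icc_right ht.2))

theorem L2_integrable (w : L2) : Integrable w intervalMeasure := (Lp.memLp w).integrable (by norm_num)

theorem continuousOn_of_eq_integral {u v : ℝ → ℂ} (hv : Integrable v intervalMeasure)
    (h : ∀ t ∈ Icc 0 (2 * Real.pi), u t = u 0 + ∫ s in (0 : ℝ)..t, v s) :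
    ContinuousOn u (Icc 0 (2 * Real.pi)) := by
  have : ContinuousOn (fun t => u 0 + ∫ s in (0 : ℝ)..t, v s) (Icc 0 (2 * Real.pi)) := by
    refine continuousOn_const.add ?_
    have := intervalIntegral.continuousOn_primitive_interval (μ := volume) (f := v)
      (a := 0) (b := 2 * Real.pi) (by rwa [uIcc_of_le Real.two_pi_pos.le])
    rwa [uIcc_of_le Real.two_pi_pos.le] at this
  exact this.congr h

theorem ae_zero_of_integral {f : ℝ → ℂ} (hf : Integrable f intervalMeasure)
    (h : ∀ t ∈ Icc 0 (2 * Real.pi), ∫ s in (0 : ℝ)..t, f s = 0) : f =ᵐ[intervalMeasure] 0 := by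
  have hi := intervalIntegrable_of_integrable hf (right_mem_Icc.2 Real.two_pi_pos.le)
  have h1 := hi.ae_hasDerivAt_integral
  have h2 : ∀ᵐ x : ℝ, x ≠ 0 ∧ x ≠ 2 * Real.pi := by
    have := (Set.toFinite ({0, 2 * Real.pi} : Set ℝ)).measure_zero volume
    filter_upwards [measure_eq_zero_iff_ae_notMem.1 this] with x hx
    simpa using hx
  refine (ae_restrict_iff' measurableSet_Icc).2 ?_
  filter_upwards [h1, h2] with x hx hne hxI
  have hx' := hx (by rwa [uIcc_of_le Real.two_pi_pos.le]) 0
    (by rw [uIcc_of_le Real.two_pi_pos.le]; exact left_mem_Icc.2 Real.two_pi_pos.le)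
  have hev : (fun t => ∫ s in (0 : ℝ)..t, f s) =ᶠ[nhds x] fun _ => 0 := by
    filter_upwards [Icc_mem_nhds (lt_of_le_of_ne hxI.1 hne.1.symm) (lt_of_le_of_ne hxI.2 hne.2)]
      with t ht using h t ht
  exact hx'.unique ((hasDerivAt_const x 0).congr_of_eventuallyEq hev)

theorem eqOn_zero_of_ae {u : ℝ → ℂ} (hc : ContinuousOn u (Icc 0 (2 * Real.pi)))
    (h : u =ᵐ[intervalMeasure] 0) : ∀ t ∈ Icc 0 (2 * Real.pi), u t = 0 :=
  Measure.eqOn_Icc_of_ae_eq volume Real.two_pi_pos.ne h hc continuousOn_const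

namespace IsW22

variable {y y' : L2} {u u' v v' : ℝ → ℂ} {w w' : L2}

theorem continuousOn_deriv (h : IsW22 y u v w) : ContinuousOn v (Icc 0 (2 * Real.pi)) :=
  continuousOn_of_eq_integral (L2_integrable w) h.deriv_eq_integral

theorem integrable_deriv (h : IsW22 y u v w) : Integrable v intervalMeasure :=
  h.continuousOn_deriv.integrableOn_Icc

theorem continuousOn (h : IsW22 y u v w) : ContinuousOn u (Icc 0 (2 * Real.pi)) :=
  continuousOn_of_eq_integral h.integrable_deriv h.eq_integral

theorem add (h : IsW22 y u v w) (h' : IsW22 y' u' v' w') :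
    IsW22 (y + y') (u + u') (v + v') (w + w') where
  ae_eq := (Lp.coeFn_add y y').trans (h.ae_eq.add h'.ae_eq)
  eq_integral t ht := by
    simp only [Pi.add_apply]
    rw [intervalIntegral.integral_add (intervalIntegrable_of_integrable h.integrable_deriv ht)
      (intervalIntegrable_of_integrable h'.integrable_deriv ht), h.eq_integral t ht,
      h'.eq_integral t ht]
    ring
  deriv_eq_integral t ht := by
    rw [integral_congr (Lp.coeFn_add w w') ht]
    simp only [Pi.add_apply]
    rw [intervalIntegral.integral_add (intervalIntegrable_of_integrable (L2_integrable w) ht)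
      (intervalIntegrable_of_integrable (L2_integrable w') ht), h.deriv_eq_integral t ht,
      h'.deriv_eq_integral t ht]
    ring

theorem smul (c : ℂ) (h : IsW22 y u v w) : IsW22 (c • y) (c • u) (c • v) (c • w) where
  ae_eq := (Lp.coeFn_smul c y).trans (h.ae_eq.const_smul c)
  eq_integral t ht := by
    simp only [Pi.smul_apply]
    rw [intervalIntegral.integral_smul, h.eq_integral t ht, smul_add]
  deriv_eq_integral t ht := by
    rw [integral_congr (Lp.coeFn_smul c w) ht]
    simp only [Pi.smul_apply]
    rw [intervalIntegral.integral_smul, h.deriv_eq_integral t ht, smul_add]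

theorem zero : IsW22 0 0 0 0 where
  ae_eq := Lp.coeFn_zero ℂ 2 intervalMeasure
  eq_integral t ht := by simp
  deriv_eq_integral t ht := by
    rw [integral_congr (Lp.coeFn_zero ℂ 2 intervalMeasure) ht]
    simp

/-- The representative, its derivative and the second weak derivative are unique. -/
theorem eq_zero (h : IsW22 0 u v w) :
    (∀ t ∈ Icc 0 (2 * Real.pi), u t = 0) ∧ (∀ t ∈ Icc 0 (2 * Real.pi), v t = 0) ∧ w = 0 := by
  have hu := eqOn_zero_of_ae h.continuousOn (h.ae_eq.symm.trans (Lp.coeFn_zero ℂ 2 intervalMeasure))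
  have h0 : (0 : ℝ) ∈ Icc 0 (2 * Real.pi) := left_mem_Icc.2 Real.two_pi_pos.le
  have hv := eqOn_zero_of_ae h.continuousOn_deriv (ae_zero_of_integral h.integrable_deriv
    fun t ht => by simpa [hu t ht, hu 0 h0] using (h.eq_integral t ht).symm)
  refine ⟨hu, hv, ?_⟩
  refine Lp.ext ((ae_zero_of_integral (L2_integrable w) fun t ht => ?_).trans
    (Lp.coeFn_zero ℂ 2 intervalMeasure).symm)
  simpa [hv t ht, hv 0 h0] using (h.deriv_eq_integral t ht).symm

theorem second_unique (h : IsW22 y u v w) (h' : IsW22 y u' v' w') : w = w' := by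
  have h2 : IsW22 0 (u + (-1 : ℂ) • u') (v + (-1 : ℂ) • v') (w + (-1 : ℂ) • w') := by
    have := h.add (h'.smul (-1))
    rwa [neg_one_smul ℂ y, add_neg_cancel] at this
  have h3 := h2.eq_zero.2.2
  rw [neg_one_smul] at h3
  exact (sub_eq_zero.1 (by rwa [sub_eq_add_neg]))

end IsW22

/-- `D̄(ω, 2π) = {y ∈ W^{2,2}([0, 2π], ℂ) | y(2π) = ω y(0), y'(2π) = ω y'(0)}`. -/
def Dbar (ω : ℂ) : Submodule ℂ L2 where
  carrier := {y | ∃ u v w, IsW22 y u v w ∧ u (2 * Real.pi) = ω * u 0 ∧ v (2 * Real.pi) = ω * v 0}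
  add_mem' := by
    rintro y y' ⟨u, v, w, h, hu, hv⟩ ⟨u', v', w', h', hu', hv'⟩
    exact ⟨_, _, _, h.add h', by simp [hu, hu', mul_add], by simp [hv, hv', mul_add]⟩
  zero_mem' := ⟨_, _, _, IsW22.zero, by simp, by simp⟩
  smul_mem' := by
    rintro c y ⟨u, v, w, h, hu, hv⟩
    exact ⟨_, _, _, h.smul c, by simp [hu, mul_left_comm], by simp [hv, mul_left_comm]⟩

theorem Dbar.exists_second {ω : ℂ} (y : Dbar ω) : ∃ w, ∃ u v, IsW22 y u v w := by
  obtain ⟨u, v, w, h, -⟩ := y.2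
  exact ⟨w, u, v, h⟩

/-- The second weak derivative on `D̄(ω, 2π)`. -/
def secondDeriv (ω : ℂ) : Dbar ω →ₗ[ℂ] L2 where
  toFun y := (Dbar.exists_second y).choose
  map_add' y y' := by
    obtain ⟨u, v, h⟩ := (Dbar.exists_second y).choose_spec
    obtain ⟨u', v', h'⟩ := (Dbar.exists_second y').choose_spec
    obtain ⟨u'', v'', h''⟩ := (Dbar.exists_second (y + y')).choose_spec
    exact h''.second_unique (h.add h')
  map_smul' c y := by
    obtain ⟨u, v, h⟩ := (Dbar.exists_second y).choose_spec
    obtain ⟨u'', v'', h''⟩ := (Dbar.exists_second (c • y)).choose_spec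
    exact h''.second_unique (h.smul c)

theorem potential_mul_memLp (β : ℝ) (e : Ico (0 : ℝ) 1) (y : L2) :
    MemLp (fun t => (potential β e t : ℂ) * y t) 2 intervalMeasure := by
  refine (Lp.memLp y).of_le_mul (c := |β| / (1 - e)) ?_ (ae_of_all _ fun t => ?_)
  · have := (potential_contDiff β e (n := 0)).continuous
    exact (Complex.continuous_ofReal.comp this).aestronglyMeasurable.mul
      (Lp.aestronglyMeasurable y)
  · rw [norm_mul, Complex.norm_real]
    gcongr
    exact potential_abs_le β e t

/-- Multiplication by `β / (1 + e cos t)` on `L²`. -/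
def potentialMul (β : ℝ) (e : Ico (0 : ℝ) 1) : L2 →ₗ[ℂ] L2 where
  toFun y := (potential_mul_memLp β e y).toLp
  map_add' y y' := by
    rw [← MemLp.toLp_add]
    refine MemLp.toLp_congr _ _ ?_
    filter_upwards [Lp.coeFn_add y y'] with t ht
    simp only [ht, Pi.add_apply, mul_add]
  map_smul' c y := by
    rw [RingHom.id_apply, ← MemLp.toLp_const_smul]
    refine MemLp.toLp_congr _ _ ?_
    filter_upwards [Lp.coeFn_smul c y] with t ht
    simp only [ht, Pi.smul_apply, smul_eq_mul, mul_left_comm]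

/-- The operator `A(β, e) = -d²/dt² - 1 + β / (1 + e cos t)` on `L²([0, 2π], ℂ)` with domain
`D̄(ω, 2π)`. -/
def slOperator (β : ℝ) (e : Ico (0 : ℝ) 1) (ω : ℂ) : L2 →ₗ.[ℂ] L2 where
  domain := Dbar ω
  toFun := -secondDeriv ω - (Dbar ω).subtype + potentialMul β e ∘ₗ (Dbar ω).subtype

theorem measurePreserving_reflect : MeasurePreserving (fun t : ℝ => 2 * Real.pi - t) intervalMeasure intervalMeasure := by
  have h := (Measure.measurePreserving_sub_left (volume : Measure ℝ) (2 * Real.pi)).restrict_preimage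
    (measurableSet_Icc (a := 0) (b := 2 * Real.pi))
  simpa using h

/-- The operator `(g z)(t) = -z(2π - t)` on `L²`. -/
def reflection : L2 →ₗ[ℂ] L2 :=
  -Lp.compMeasurePreservingₗ ℂ (fun t : ℝ => 2 * Real.pi - t) measurePreserving_reflect

theorem coeFn_reflection (z : L2) :
    reflection z =ᵐ[intervalMeasure] fun t => -z (2 * Real.pi - t) := by
  have h1 := Lp.coeFn_neg (Lp.compMeasurePreserving _ measurePreserving_reflect z)
  have h2 := Lp.coeFn_compMeasurePreserving z measurePreserving_reflect
  filter_upwards [h1, h2] with t ht1 ht2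
  exact ht1.trans (congrArg Neg.neg ht2)

/-- `E₁ = ker (g + 1)` in `D̄(-1, 2π)`: the functions whose extension by `z(t + 2π) = -z(t)` is odd,
since for this extension `(g z)(t) = z(-t)`. -/
def oddSubspace : Submodule ℂ L2 := Dbar (-1) ⊓ LinearMap.ker (reflection + LinearMap.id)

/-- `E₂ = ker (g - 1)` in `D̄(-1, 2π)`: the functions whose extension by `z(t + 2π) = -z(t)` is
even. -/
def evenSubspace : Submodule ℂ L2 := Dbar (-1) ⊓ LinearMap.ker (reflection - LinearMap.id)

/-- An operator is degenerate if its kernel is nonzero. -/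
def IsDegenerate (T : L2 →ₗ.[ℂ] L2) : Prop := LinearMap.ker T.toFun ≠ ⊥

/-- `(b(e), e)`, `e ∈ [0,1)`, is the degeneracy curve in `[0,1] × [0,1)` of the restriction to `S`
of `A(β, e)` with domain `D̄(-1, 2π)`: the restriction is degenerate exactly on this curve. -/
def IsDegeneracyCurveOn (S : Submodule ℂ L2) (b : ℝ → ℝ) : Prop :=
  ∀ (e : Ico (0 : ℝ) 1), ∀ β ∈ Icc (0 : ℝ) 1,
    IsDegenerate ((slOperator β e (-1)).domRestrict S) ↔ β = b e

end SturmLiouville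

end

open SturmLiouville

noncomputable section

namespace SturmLiouville


/-! ### The Volterra operator of `d²/dt² + 1` on `[0, π]` -/

/-- Real-valued continuous functions on `[0, π]`. -/
abbrev HalfC : Type := C(Icc (0 : ℝ) Real.pi, ℝ)

/-- Extension of a continuous function on `[0, π]` to the line by constants. -/
def extend (f : HalfC) : ℝ → ℝ := IccExtend Real.pi_pos.le f

theorem extend_continuous (f : HalfC) : Continuous (extend f) := f.continuous.Icc_extend'

theorem extend_of_mem (f : HalfC) {t : ℝ} (ht : t ∈ Icc (0 : ℝ) Real.pi) :
    extend f t = f ⟨t, ht⟩ := IccExtend_of_mem _ _ ht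

theorem abs_extend_le (f : HalfC) (t : ℝ) : |extend f t| ≤ ‖f‖ := f.norm_coe_le_norm _

/-- `∫₀ᵗ sin (t - s) F(s) ds`, expanded by the addition theorem. -/
def duhamel (F : ℝ → ℝ) (t : ℝ) : ℝ :=
  Real.sin t * (∫ s in (0 : ℝ)..t, Real.cos s * F s) -
    Real.cos t * ∫ s in (0 : ℝ)..t, Real.sin s * F s

/-- `∫₀ᵗ cos (t - s) F(s) ds`, expanded by the addition theorem. -/
def duhamelDeriv (F : ℝ → ℝ) (t : ℝ) : ℝ :=
  Real.cos t * (∫ s in (0 : ℝ)..t, Real.cos s * F s) +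
    Real.sin t * ∫ s in (0 : ℝ)..t, Real.sin s * F s

theorem duhamel_eq {F : ℝ → ℝ} (hF : Continuous F) (t : ℝ) :
    duhamel F t = ∫ s in (0 : ℝ)..t, Real.sin (t - s) * F s := by
  unfold duhamel
  rw [← intervalIntegral.integral_const_mul, ← intervalIntegral.integral_const_mul,
    ← intervalIntegral.integral_sub]
  · refine intervalIntegral.integral_congr fun s _ => ?_
    simp only [Real.sin_sub]
    ring
  all_goals exact Continuous.intervalIntegrable (by fun_prop) _ _

theorem hasDerivAt_duhamel {F : ℝ → ℝ} (hF : Continuous F) (t : ℝ) :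
    HasDerivAt (duhamel F) (duhamelDeriv F t) t := by
  have h1 : HasDerivAt (fun t => ∫ s in (0 : ℝ)..t, Real.cos s * F s) (Real.cos t * F t) t :=
    (Real.continuous_cos.mul hF).integral_hasStrictDerivAt 0 t |>.hasDerivAt
  have h2 : HasDerivAt (fun t => ∫ s in (0 : ℝ)..t, Real.sin s * F s) (Real.sin t * F t) t :=
    (Real.continuous_sin.mul hF).integral_hasStrictDerivAt 0 t |>.hasDerivAt
  convert! ((Real.hasDerivAt_sin t).mul h1).sub ((Real.hasDerivAt_cos t).mul h2) using 1
  unfold duhamelDeriv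
  ring

theorem hasDerivAt_duhamelDeriv {F : ℝ → ℝ} (hF : Continuous F) (t : ℝ) :
    HasDerivAt (duhamelDeriv F) (F t - duhamel F t) t := by
  have h1 : HasDerivAt (fun t => ∫ s in (0 : ℝ)..t, Real.cos s * F s) (Real.cos t * F t) t :=
    (Real.continuous_cos.mul hF).integral_hasStrictDerivAt 0 t |>.hasDerivAt
  have h2 : HasDerivAt (fun t => ∫ s in (0 : ℝ)..t, Real.sin s * F s) (Real.sin t * F t) t :=
    (Real.continuous_sin.mul hF).integral_hasStrictDerivAt 0 t |>.hasDerivAt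
  convert! ((Real.hasDerivAt_cos t).mul h1).add ((Real.hasDerivAt_sin t).mul h2) using 1
  unfold duhamel
  linear_combination -(F t) * Real.sin_sq_add_cos_sq t

theorem duhamel_zero (F : ℝ → ℝ) : duhamel F 0 = 0 := by simp [duhamel]

theorem duhamelDeriv_zero (F : ℝ → ℝ) : duhamelDeriv F 0 = 0 := by simp [duhamelDeriv]

theorem duhamel_nonneg {F : ℝ → ℝ} (hF : Continuous F) (h0 : ∀ s ∈ Icc (0 : ℝ) Real.pi, 0 ≤ F s)
    {t : ℝ} (ht : t ∈ Icc (0 : ℝ) Real.pi) : 0 ≤ duhamel F t := by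
  rw [duhamel_eq hF]
  refine intervalIntegral.integral_nonneg ht.1 fun s hs => mul_nonneg ?_ (h0 s ⟨hs.1, hs.2.trans ht.2⟩)
  exact Real.sin_nonneg_of_nonneg_of_le_pi (by linarith [hs.2]) (by linarith [hs.1, ht.2])

theorem abs_duhamel_le {F G : ℝ → ℝ} (hF : Continuous F) (hG : Continuous G) {t : ℝ} (ht : 0 ≤ t)
    (h : ∀ s ∈ Icc (0 : ℝ) t, |F s| ≤ G s) : |duhamel F t| ≤ ∫ s in (0 : ℝ)..t, G s := by
  rw [duhamel_eq hF]
  rw [← Real.norm_eq_abs]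
  refine intervalIntegral.norm_integral_le_of_norm_le (μ := volume) ht (ae_of_all _ fun s hs => ?_)
    (hG.intervalIntegrable _ _)
  rw [Real.norm_eq_abs, abs_mul]
  have := h s ⟨hs.1.le, hs.2⟩
  nlinarith [Real.abs_sin_le_one (t - s), abs_nonneg (F s)]

/-- The Volterra operator `f ↦ ∫₀ᵗ sin (t - s) f(s) ds` on `C([0, π])`. -/
def volterra : HalfC →L[ℝ] HalfC :=
  LinearMap.mkContinuous
    { toFun := fun f => ⟨fun t => duhamel (extend f) t,
        (continuous_iff_continuousAt.2 fun t =>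
          (hasDerivAt_duhamel (extend_continuous f) t).continuousAt).comp continuous_subtype_val⟩
      map_add' := fun f g => by
        ext t
        have hf := extend_continuous f
        have hg := extend_continuous g
        have : extend (f + g) = fun s => extend f s + extend g s := rfl
        simp only [ContinuousMap.coe_mk, ContinuousMap.add_apply]
        rw [duhamel_eq (extend_continuous _), duhamel_eq hf, duhamel_eq hg,
          ← intervalIntegral.integral_add, this]
        · simp only [mul_add]
        all_goals exact Continuous.intervalIntegrable (by fun_prop) _ _
      map_smul' := fun c f => by
        ext t
        have : extend (c • f) = fun s => c * extend f s := rfl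
        simp only [ContinuousMap.coe_mk, ContinuousMap.smul_apply, RingHom.id_apply, smul_eq_mul]
        rw [duhamel_eq (extend_continuous _), duhamel_eq (extend_continuous _),
          ← intervalIntegral.integral_const_mul, this]
        simp only [mul_left_comm] }
    Real.pi fun f => by
      refine (ContinuousMap.norm_le _ (by positivity)).2 fun t => ?_
      refine (abs_duhamel_le (G := fun _ => ‖f‖) (extend_continuous f) continuous_const t.2.1
        fun s _ => abs_extend_le f s).trans ?_
      rw [intervalIntegral.integral_const, sub_zero, smul_eq_mul]
      exact mul_le_mul_of_nonneg_right t.2.2 (norm_nonneg _)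

/-- The operator `f ↦ ∫₀ᵗ sin (t - s) q(s) f(s) ds` on `C([0, π])`. -/
def volterraMul (q : HalfC) : HalfC →L[ℝ] HalfC := volterra ∘L ContinuousLinearMap.mul ℝ HalfC q

theorem volterraMul_apply (q f : HalfC) (t : Icc (0 : ℝ) Real.pi) :
    volterraMul q f t = duhamel (extend (q * f)) t := rfl

theorem abs_volterraMul_pow_le (q f : HalfC) (n : ℕ) (t : Icc (0 : ℝ) Real.pi) :
    |(volterraMul q ^ n) f t| ≤ (‖q‖ * t) ^ n / n.factorial * ‖f‖ := by
  induction n generalizing t with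
  | zero => simpa using f.norm_coe_le_norm t
  | succ n ih =>
    rw [pow_succ', mul_apply_eq_comp, volterraMul_apply]
    refine (abs_duhamel_le (G := fun s => ‖q‖ ^ (n + 1) / n.factorial * ‖f‖ * s ^ n)
      (extend_continuous _) (by fun_prop) t.2.1 fun s hs => ?_).trans ?_
    · have hs' : s ∈ Icc (0 : ℝ) Real.pi := ⟨hs.1, hs.2.trans t.2.2⟩
      rw [extend_of_mem _ hs', ContinuousMap.mul_apply, abs_mul]
      refine (mul_le_mul (q.norm_coe_le_norm _) (ih ⟨s, hs'⟩) (abs_nonneg _) (norm_nonneg _)).trans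
        (le_of_eq ?_)
      simp only [mul_pow, pow_succ]
      ring
    · rw [intervalIntegral.integral_const_mul, integral_pow]
      refine le_of_eq ?_
      rw [Nat.factorial_succ]
      push_cast
      have : (n : ℝ) + 1 ≠ 0 := by positivity
      have : (n.factorial : ℝ) ≠ 0 := by positivity
      field_simp
      simp only [mul_pow]
      ring

theorem tendsto_norm_volterraMul_pow (q : HalfC) :
    Filter.Tendsto (fun n => ‖volterraMul q ^ n‖) Filter.atTop (nhds 0) := by
  refine squeeze_zero (fun n => norm_nonneg (E := HalfC →L[ℝ] HalfC) _) (fun n => ?_)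
    (FloorSemiring.tendsto_pow_div_factorial_atTop (‖q‖ * Real.pi))
  refine ContinuousLinearMap.opNorm_le_bound _ (by positivity) fun f => ?_
  refine (ContinuousMap.norm_le _ (by positivity)).2 fun t => ?_
  refine (abs_volterraMul_pow_le q f n t).trans ?_
  have := t.2.1
  have := t.2.2
  gcongr

theorem isUnit_one_sub_volterraMul (q : HalfC) : IsUnit (1 - volterraMul q) := by
  obtain ⟨n, hn⟩ := ((tendsto_norm_volterraMul_pow q).eventually_lt_const one_pos).exists
  have h := isUnit_one_sub_of_norm_lt_one (R := HalfC →L[ℝ] HalfC) hn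
  rw [← mul_neg_geom_sum] at h
  refine ((Commute.isUnit_mul_iff ?_).1 h).1
  exact (Commute.one_left _).sub_left (Commute.sum_right _ _ _ fun i _ =>
    Commute.self_pow _ i)

/-- `sin` on `[0, π]`. -/
def sinHalf : HalfC := ⟨fun t => Real.sin t, by fun_prop⟩

/-- The solution of `u'' = (q - 1) u`, `u(0) = 0`, `u'(0) = 1`, on `[0, π]`. -/
def dirichletSol (q : HalfC) : HalfC := Ring.inverse (1 - volterraMul q) sinHalf

theorem dirichletSol_eq (q : HalfC) :
    dirichletSol q = sinHalf + volterraMul q (dirichletSol q) := by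
  have h := Ring.mul_inverse_cancel _ (isUnit_one_sub_volterraMul q)
  have h2 := congrArg (fun T : HalfC →L[ℝ] HalfC => T sinHalf) h
  simp only [mul_apply_eq_comp, one_apply_eq_self,
    _root_.sub_apply] at h2
  exact sub_eq_iff_eq_add.1 h2

/-- Comparison with `q = 0`. -/
theorem sin_le_dirichletSol {q : HalfC} (hq : 0 ≤ q) (t : Icc (0 : ℝ) Real.pi) :
    Real.sin t ≤ dirichletSol q t := by
  have key : ∀ n, sinHalf ≤ dirichletSol q - (volterraMul q ^ (n + 1)) (dirichletSol q) := by
    intro n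
    induction n with
    | zero =>
      rw [zero_add, pow_one]
      exact (eq_sub_of_add_eq (dirichletSol_eq q).symm).le
    | succ n ih =>
      have h0 : (0 : HalfC) ≤ volterraMul q
          (dirichletSol q - (volterraMul q ^ (n + 1)) (dirichletSol q)) := fun t =>
        duhamel_nonneg (extend_continuous _) (fun s hs => by
          rw [extend_of_mem _ hs]
          exact mul_nonneg (hq _)
            ((Real.sin_nonneg_of_nonneg_of_le_pi hs.1 hs.2).trans (ih ⟨s, hs⟩))) t.2
      rw [map_sub, ← mul_apply_eq_comp, ← pow_succ'] at h0
      have h1 := dirichletSol_eq q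
      intro t
      have h2 : 0 ≤ volterraMul q (dirichletSol q) t -
        (volterraMul q ^ (n + 1 + 1)) (dirichletSol q) t := h0 t
      have h3 : dirichletSol q t = sinHalf t + volterraMul q (dirichletSol q) t :=
        congrArg (fun f : HalfC => f t) h1
      have h4 : sinHalf t ≤ dirichletSol q t -
        (volterraMul q ^ (n + 1 + 1)) (dirichletSol q) t := by linarith
      exact h4
  have hlim : Filter.Tendsto (fun n => dirichletSol q t - (volterraMul q ^ (n + 1)) (dirichletSol q) t)
      Filter.atTop (nhds (dirichletSol q t - 0)) := by
    refine tendsto_const_nhds.sub ?_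
    refine squeeze_zero_norm (fun n => ?_) (a := fun n => ‖volterraMul q ^ (n + 1)‖ * ‖dirichletSol q‖) ?_
    · exact (ContinuousMap.norm_coe_le_norm _ t).trans (ContinuousLinearMap.le_opNorm _ _)
    · simpa using ((tendsto_norm_volterraMul_pow q).comp (Filter.tendsto_add_atTop_nat 1)).mul_const _
  rw [sub_zero] at hlim
  exact ge_of_tendsto' hlim fun n => key n t

/-- `y' = x`, `x' = (q - 1) y` on `s`. -/
def IsSolOn (q y x : ℝ → ℝ) (s : Set ℝ) : Prop :=
  ∀ t ∈ s, HasDerivAt y (x t) t ∧ HasDerivAt x ((q t - 1) * y t) t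

/-- The differentiable extension of `dirichletSol q` to the line. -/
def dirichletFun (q : HalfC) (t : ℝ) : ℝ :=
  Real.sin t + duhamel (extend (q * dirichletSol q)) t

/-- The derivative of `dirichletFun q`. -/
def dirichletDeriv (q : HalfC) (t : ℝ) : ℝ :=
  Real.cos t + duhamelDeriv (extend (q * dirichletSol q)) t

theorem dirichletFun_eq (q : HalfC) (t : Icc (0 : ℝ) Real.pi) :
    dirichletFun q t = dirichletSol q t :=
  (congrArg (fun f : HalfC => f t) (dirichletSol_eq q)).symm

theorem dirichletFun_zero (q : HalfC) : dirichletFun q 0 = 0 := by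
  simp [dirichletFun, duhamel_zero]

theorem dirichletDeriv_zero (q : HalfC) : dirichletDeriv q 0 = 1 := by
  simp [dirichletDeriv, duhamelDeriv_zero]

theorem isSolOn_dirichletFun (q : HalfC) :
    IsSolOn (extend q) (dirichletFun q) (dirichletDeriv q) (Icc 0 Real.pi) := by
  intro t ht
  refine ⟨(Real.hasDerivAt_sin t).add (hasDerivAt_duhamel (extend_continuous _) t), ?_⟩
  convert! (Real.hasDerivAt_cos t).add (hasDerivAt_duhamelDeriv (extend_continuous _) t) using 1
  rw [extend_of_mem _ ht, extend_of_mem _ ht, ContinuousMap.mul_apply, ← dirichletFun_eq]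
  simp only [dirichletFun]
  ring

/-- The linear functional `f ↦ ∫₀^π cos s f(s) ds` on `C([0, π])`. -/
def cosIntegral : HalfC →L[ℝ] ℝ :=
  LinearMap.mkContinuous
    { toFun := fun f => ∫ s in (0 : ℝ)..Real.pi, Real.cos s * extend f s
      map_add' := fun f g => by
        have hf := extend_continuous f
        have hg := extend_continuous g
        have : extend (f + g) = fun s => extend f s + extend g s := rfl
        rw [← intervalIntegral.integral_add, this]
        · simp only [mul_add]
        all_goals exact Continuous.intervalIntegrable (by fun_prop) _ _
      map_smul' := fun c f => by
        have : extend (c • f) = fun s => c * extend f s := rfl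
        simp only [RingHom.id_apply, smul_eq_mul]
        rw [← intervalIntegral.integral_const_mul, this]
        simp only [mul_left_comm] }
    Real.pi fun f => by
      refine (intervalIntegral.norm_integral_le_of_norm_le_const (C := ‖f‖) fun s _ => ?_).trans ?_
      · rw [Real.norm_eq_abs, abs_mul]
        have := abs_extend_le f s
        nlinarith [Real.abs_cos_le_one s, abs_nonneg (extend f s)]
      · rw [sub_zero, abs_of_pos Real.pi_pos, mul_comm]

theorem dirichletDeriv_pi (q : HalfC) :
    dirichletDeriv q Real.pi = -1 - cosIntegral (q * dirichletSol q) := by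
  have : cosIntegral (q * dirichletSol q) =
    ∫ s in (0 : ℝ)..Real.pi, Real.cos s * extend (q * dirichletSol q) s := rfl
  rw [this]
  simp only [dirichletDeriv, duhamelDeriv, Real.cos_pi, Real.sin_pi]
  ring

theorem analyticAt_inverse_one_sub_comp_mul {A : Type*} [NormedCommRing A] [NormedAlgebra ℝ A]
    [CompleteSpace A] (V : A →L[ℝ] A) (s q : A)
    (h : IsUnit (1 - V ∘L ContinuousLinearMap.mul ℝ A q)) :
    AnalyticAt ℝ (fun q => Ring.inverse (1 - V ∘L ContinuousLinearMap.mul ℝ A q) s) q := by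
  let Φ : A →L[ℝ] A →L[ℝ] A :=
    ContinuousLinearMap.compL ℝ A A A V ∘L ContinuousLinearMap.mul ℝ A
  have h1 : AnalyticAt ℝ (fun q : A => 1 - Φ q) q := analyticAt_const.sub (Φ.analyticAt q)
  have h2 := (analyticAt_inverse (𝕜 := ℝ) h.unit).comp_of_eq h1 rfl
  exact ((ContinuousLinearMap.apply ℝ A s).analyticAt _).comp h2

theorem analyticAt_dirichletSol (q : HalfC) : AnalyticAt ℝ dirichletSol q :=
  analyticAt_inverse_one_sub_comp_mul volterra sinHalf q (isUnit_one_sub_volterraMul q)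

theorem analyticAt_dirichletDeriv_pi (q : HalfC) :
    AnalyticAt ℝ (fun q => dirichletDeriv q Real.pi) q := by
  simp only [dirichletDeriv_pi]
  have h : AnalyticAt ℝ (fun q : HalfC => q * dirichletSol q) q :=
    analyticAt_id.mul (analyticAt_dirichletSol q)
  exact analyticAt_const.sub ((cosIntegral.analyticAt _).comp h)


/-! ### The shooting function and its zero -/

theorem IsSolOn.hasDerivAt_wronskian {q₁ q₂ y₁ y₂ x₁ x₂ : ℝ → ℝ} {s : Set ℝ}
    (h₁ : IsSolOn q₁ y₁ x₁ s) (h₂ : IsSolOn q₂ y₂ x₂ s) {t : ℝ} (ht : t ∈ s) :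
    HasDerivAt (fun t => y₁ t * x₂ t - y₂ t * x₁ t) ((q₂ t - q₁ t) * (y₁ t * y₂ t)) t := by
  convert! ((h₁ t ht).1.mul (h₂ t ht).2).sub ((h₂ t ht).1.mul (h₁ t ht).2) using 1
  ring

theorem eq_of_hasDerivAt_zero {E : Type*} [NormedAddCommGroup E] [NormedSpace ℝ E]
    {f : ℝ → E} {a b : ℝ}
    (hc : ContinuousOn f (Icc a b)) (h : ∀ t ∈ Ioo a b, HasDerivAt f 0 t) {s t : ℝ}
    (hs : s ∈ Icc a b) (ht : t ∈ Icc a b) : f s = f t := by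
  have key : ∀ c ∈ Ioo a b, ∀ t ∈ Icc c b, f t = f c := fun c hc' =>
    constant_of_has_deriv_right_zero (hc.mono (Icc_subset_Icc_left hc'.1.le))
      fun x hx => (h x ⟨hc'.1.trans_le hx.1, hx.2⟩).hasDerivWithinAt
  rcases eq_or_lt_of_le (hs.1.trans hs.2) with hab | hab
  · rw [le_antisymm (hs.2.trans (hab ▸ ht.1)) (ht.2.trans (hab ▸ hs.1))]
  have hr : ∀ t ∈ Icc a b, t ≠ a → f t = f b := fun t ht hta => by
    rcases eq_or_lt_of_le ht.2 with rfl | htb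
    · rfl
    · exact (key t ⟨lt_of_le_of_ne ht.1 hta.symm, htb⟩ b (right_mem_Icc.2 htb.le)).symm
  have ha : f a = f b := by
    have h1 : Filter.Tendsto f (nhdsWithin a (Ioo a b)) (nhds (f a)) :=
      (hc a (left_mem_Icc.2 hab.le)).mono_left (nhdsWithin_mono _ Ioo_subset_Icc_self)
    have h2 : Filter.Tendsto f (nhdsWithin a (Ioo a b)) (nhds (f b)) := by
      refine tendsto_const_nhds.congr' ?_
      filter_upwards [self_mem_nhdsWithin] with x hx
      exact (hr x (Ioo_subset_Icc_self hx) hx.1.ne').symm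
    have : (nhdsWithin a (Ioo a b)).NeBot := left_nhdsWithin_Ioo_neBot hab
    exact tendsto_nhds_unique h1 h2
  have hr' : ∀ t ∈ Icc a b, f t = f b := fun t ht => by
    rcases eq_or_ne t a with rfl | hta
    · exact ha
    · exact hr t ht hta
  rw [hr' s hs, hr' t ht]

/-- The Wronskian of two solutions of the same equation is constant. -/
theorem IsSolOn.wronskian_eq {q y₁ y₂ x₁ x₂ : ℝ → ℝ} {a b : ℝ}
    (h₁ : IsSolOn q y₁ x₁ (Icc a b)) (h₂ : IsSolOn q y₂ x₂ (Icc a b)) {s t : ℝ}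
    (hs : s ∈ Icc a b) (ht : t ∈ Icc a b) :
    y₁ s * x₂ s - y₂ s * x₁ s = y₁ t * x₂ t - y₂ t * x₁ t := by
  have h : ∀ t ∈ Icc a b, HasDerivAt (fun t => y₁ t * x₂ t - y₂ t * x₁ t) 0 t := fun t ht => by
    simpa using h₁.hasDerivAt_wronskian h₂ ht
  exact eq_of_hasDerivAt_zero (fun t ht => (h t ht).continuousAt.continuousWithinAt)
    (fun t ht => h t (Ioo_subset_Icc_self ht)) hs ht

theorem one_add_mul_cos_pos {a : ℝ} (ha : a ∈ Ioo (-1 : ℝ) 1) (t : ℝ) : 0 < 1 + a * Real.cos t := by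
  have h := abs_lt.2 ha
  have h2 : |a * Real.cos t| ≤ |a| := by
    rw [abs_mul]
    nlinarith [Real.abs_cos_le_one t, abs_nonneg a]
  linarith [(abs_le.1 h2).1]

/-- `1 + a cos t` on `[0, π]`. -/
def weight (a : ℝ) : HalfC := 1 + a • ⟨fun t => Real.cos t, by fun_prop⟩

theorem isUnit_weight {a : ℝ} (ha : a ∈ Ioo (-1 : ℝ) 1) : IsUnit (weight a) :=
  (ContinuousMap.isUnit_iff_forall_ne_zero _).2 fun t => (one_add_mul_cos_pos ha t).ne'

/-- `β / (1 + a cos t)` on `[0, π]`, for a pair `(a, β)`. -/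
def coeff (p : ℝ × ℝ) : HalfC := p.2 • Ring.inverse (weight p.1)

theorem coeff_apply {a : ℝ} (ha : a ∈ Ioo (-1 : ℝ) 1) (β : ℝ) (t : Icc (0 : ℝ) Real.pi) :
    coeff (a, β) t = β / (1 + a * Real.cos t) := by
  have h1 := congrArg (fun f : HalfC => f t) (Ring.mul_inverse_cancel _ (isUnit_weight ha))
  have h2 : (1 + a * Real.cos t) * Ring.inverse (weight a) t = 1 := h1
  have h3 := (one_add_mul_cos_pos ha t).ne'
  rw [eq_div_iff h3]
  change β * Ring.inverse (weight a) t * _ = β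
  linear_combination β * h2

theorem extend_coeff {a : ℝ} (ha : a ∈ Ioo (-1 : ℝ) 1) (β : ℝ) {t : ℝ}
    (ht : t ∈ Icc (0 : ℝ) Real.pi) : extend (coeff (a, β)) t = β / (1 + a * Real.cos t) := by
  rw [extend_of_mem _ ht, coeff_apply ha]

theorem analyticAt_smul_inverse_affine {A : Type*} [NormedCommRing A] [NormedAlgebra ℝ A]
    [CompleteSpace A] (c : A) (p : ℝ × ℝ) (h : IsUnit (1 + p.1 • c)) :
    AnalyticAt ℝ (fun p : ℝ × ℝ => p.2 • Ring.inverse (1 + p.1 • c)) p := by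
  have h1 : AnalyticAt ℝ (fun p : ℝ × ℝ => 1 + p.1 • c) p :=
    analyticAt_const.add (analyticAt_fst.smul analyticAt_const)
  exact analyticAt_snd.smul ((analyticAt_inverse (𝕜 := ℝ) h.unit).comp_of_eq h1 rfl)

theorem analyticAt_coeff {p : ℝ × ℝ} (hp : p.1 ∈ Ioo (-1 : ℝ) 1) : AnalyticAt ℝ coeff p :=
  analyticAt_smul_inverse_affine _ p (isUnit_weight hp)

/-- `u'(π)` for the solution of `u'' = (β / (1 + a cos t) - 1) u`, `u(0) = 0`, `u'(0) = 1`. -/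
def shoot (p : ℝ × ℝ) : ℝ := dirichletDeriv (coeff p) Real.pi

theorem analyticAt_shoot {p : ℝ × ℝ} (hp : p.1 ∈ Ioo (-1 : ℝ) 1) : AnalyticAt ℝ shoot p :=
  (analyticAt_dirichletDeriv_pi (coeff p)).comp (analyticAt_coeff hp)

theorem shoot_zero (a : ℝ) : shoot (a, 0) = -1 := by
  have : coeff (a, 0) = 0 := zero_smul _ _
  rw [shoot, dirichletDeriv_pi, this, zero_mul, map_zero, sub_zero]

/-- For `β = 1` the function `1 + a cos t` is a solution. -/
theorem shoot_one_mul {a : ℝ} (ha : a ∈ Ioo (-1 : ℝ) 1) : shoot (a, 1) * (1 - a) = 1 + a := by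
  have h1 := isSolOn_dirichletFun (coeff (a, 1))
  have h2 : IsSolOn (extend (coeff (a, 1))) (fun t => 1 + a * Real.cos t)
      (fun t => -(a * Real.sin t)) (Icc 0 Real.pi) := fun t ht => by
    constructor
    · simpa using! ((Real.hasDerivAt_cos t).const_mul a).const_add 1
    · convert! ((Real.hasDerivAt_sin t).const_mul a).neg using 1
      rw [extend_coeff ha 1 ht]
      have := (one_add_mul_cos_pos ha t).ne'
      field_simp
      ring
  have h3 := h2.wronskian_eq h1 (left_mem_Icc.2 Real.pi_pos.le) (right_mem_Icc.2 Real.pi_pos.le)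
  simp only [dirichletFun_zero, dirichletDeriv_zero, Real.cos_zero, Real.sin_zero, Real.cos_pi,
    Real.sin_pi] at h3
  unfold shoot
  linarith

theorem coeff_nonneg {a β : ℝ} (ha : a ∈ Ioo (-1 : ℝ) 1) (hβ : 0 ≤ β) : 0 ≤ coeff (a, β) :=
  fun t => by
    change 0 ≤ coeff (a, β) t
    rw [coeff_apply ha]
    exact div_nonneg hβ (one_add_mul_cos_pos ha t).le

theorem sin_le_dirichletFun {a β : ℝ} (ha : a ∈ Ioo (-1 : ℝ) 1) (hβ : 0 ≤ β) {t : ℝ}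
    (ht : t ∈ Icc (0 : ℝ) Real.pi) : Real.sin t ≤ dirichletFun (coeff (a, β)) t :=
  (sin_le_dirichletSol (coeff_nonneg ha hβ) ⟨t, ht⟩).trans (dirichletFun_eq _ ⟨t, ht⟩).ge

/-- Quantitative monotonicity of the shooting function at its zeros. -/
theorem le_mul_shoot {a β β' : ℝ} (ha : a ∈ Ioo (-1 : ℝ) 1) (hβ : 0 ≤ β) (hβ' : β ≤ β')
    (h : shoot (a, β) = 0) :
    (β' - β) * (Real.pi / 4) ≤ dirichletFun (coeff (a, β)) Real.pi * shoot (a, β') := by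
  have h1 := isSolOn_dirichletFun (coeff (a, β))
  have h2 := isSolOn_dirichletFun (coeff (a, β'))
  have hd : ∀ t ∈ Icc 0 Real.pi, HasDerivAt (fun t =>
      (dirichletFun (coeff (a, β)) t * dirichletDeriv (coeff (a, β')) t -
        dirichletFun (coeff (a, β')) t * dirichletDeriv (coeff (a, β)) t) -
        (β' - β) * ((t - Real.sin t * Real.cos t) / 4))
      ((extend (coeff (a, β')) t - extend (coeff (a, β)) t) *
        (dirichletFun (coeff (a, β)) t * dirichletFun (coeff (a, β')) t) -
        (β' - β) * (Real.sin t ^ 2 / 2)) t := fun t ht => by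
    refine (h1.hasDerivAt_wronskian h2 ht).sub (HasDerivAt.const_mul _ ?_)
    convert! ((hasDerivAt_id t).sub
      ((Real.hasDerivAt_sin t).mul (Real.hasDerivAt_cos t))).div_const 4 using 1
    linear_combination (1 / 4 : ℝ) * Real.sin_sq_add_cos_sq t
  have hmono := monotoneOn_of_hasDerivWithinAt_nonneg (convex_Icc 0 Real.pi)
    (fun t ht => (hd t ht).continuousAt.continuousWithinAt)
    (fun t ht => (hd t (interior_subset ht)).hasDerivWithinAt) (fun t ht => by
      have ht' := interior_subset ht
      have hs := Real.sin_nonneg_of_nonneg_of_le_pi ht'.1 ht'.2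
      have e1 := sin_le_dirichletFun ha hβ ht'
      have e2 := sin_le_dirichletFun ha (hβ.trans hβ') ht'
      have hw := one_add_mul_cos_pos ha t
      rw [extend_coeff ha _ ht', extend_coeff ha _ ht', ← sub_div, sub_nonneg]
      have hw2 : 1 + a * Real.cos t ≤ 2 := by
        have := one_add_mul_cos_pos (a := -a) ⟨by linarith [ha.2], by linarith [ha.1]⟩ t
        linarith
      have hw3 : (β' - β) * (1 / 2) ≤ (β' - β) / (1 + a * Real.cos t) := by
        rw [div_eq_mul_one_div (β' - β)]
        exact mul_le_mul_of_nonneg_left (one_div_le_one_div_of_le hw hw2) (sub_nonneg.2 hβ')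
      have hyy : Real.sin t ^ 2 ≤
          dirichletFun (coeff (a, β)) t * dirichletFun (coeff (a, β')) t := by
        rw [sq]
        exact mul_le_mul e1 e2 hs (hs.trans e1)
      have := mul_le_mul hw3 hyy (sq_nonneg _)
        (div_nonneg (sub_nonneg.2 hβ') hw.le)
      linarith)
  have := hmono (left_mem_Icc.2 Real.pi_pos.le) (right_mem_Icc.2 Real.pi_pos.le) Real.pi_pos.le
  have h' : dirichletDeriv (coeff (a, β)) Real.pi = 0 := h
  simp only [dirichletFun_zero, h', Real.sin_zero, Real.sin_pi] at this
  unfold shoot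
  linarith

theorem dirichletFun_pi_pos {a β : ℝ} (ha : a ∈ Ioo (-1 : ℝ) 1) (hβ : 0 ≤ β)
    (h : shoot (a, β) = 0) : 0 < dirichletFun (coeff (a, β)) Real.pi := by
  have h0 := sin_le_dirichletFun ha hβ (right_mem_Icc.2 Real.pi_pos.le)
  rw [Real.sin_pi] at h0
  refine h0.lt_of_ne fun h1 => ?_
  have := le_mul_shoot ha hβ (le_add_of_nonneg_right zero_le_one) h
  rw [← h1, zero_mul] at this
  linarith [Real.pi_pos]

theorem shoot_zero_unique {a β β' : ℝ} (ha : a ∈ Ioo (-1 : ℝ) 1) (hβ : 0 ≤ β) (hβ' : 0 ≤ β')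
    (h : shoot (a, β) = 0) (h' : shoot (a, β') = 0) : β = β' := by
  wlog hlt : β < β' generalizing β β'
  · rcases (not_lt.1 hlt).eq_or_lt with h2 | h2
    · exact h2.symm
    · exact (this hβ' hβ h' h h2).symm
  have := le_mul_shoot ha hβ hlt.le h
  rw [h', mul_zero] at this
  nlinarith [Real.pi_pos]

theorem exists_shoot_eq_zero {a : ℝ} (ha : a ∈ Ioo (-1 : ℝ) 1) :
    ∃ β ∈ Ioo (0 : ℝ) 1, shoot (a, β) = 0 := by
  have hc : ContinuousOn (fun β => shoot (a, β)) (Icc 0 1) := fun β _ =>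
    ((analyticAt_shoot (p := (a, β)) ha).continuousAt.comp
      (f := fun β : ℝ => (a, β)) (by fun_prop)).continuousWithinAt
  have h1 : 0 < shoot (a, 1) := by
    have := shoot_one_mul ha
    refine pos_of_mul_pos_left (b := 1 - a) ?_ (by linarith [ha.2])
    linarith [ha.1]
  exact intermediate_value_Ioo zero_le_one hc ⟨by simp only [shoot_zero]; norm_num, h1⟩

/-- The zero `β ∈ [0, 1]` of the shooting function. -/
def shootZero (a : ℝ) : ℝ :=
  if h : a ∈ Ioo (-1 : ℝ) 1 then (exists_shoot_eq_zero h).choose else 0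

theorem shootZero_spec {a : ℝ} (ha : a ∈ Ioo (-1 : ℝ) 1) :
    shootZero a ∈ Ioo (0 : ℝ) 1 ∧ shoot (a, shootZero a) = 0 := by
  rw [shootZero, dif_pos ha]
  exact (exists_shoot_eq_zero ha).choose_spec

theorem shoot_eq_zero_iff {a β : ℝ} (ha : a ∈ Ioo (-1 : ℝ) 1) (hβ : 0 ≤ β) :
    shoot (a, β) = 0 ↔ β = shootZero a := by
  obtain ⟨h1, h2⟩ := shootZero_spec ha
  exact ⟨fun h => shoot_zero_unique ha hβ h1.1.le h h2, fun h => h ▸ h2⟩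

theorem fderiv_shoot_ne_zero {a β : ℝ} (ha : a ∈ Ioo (-1 : ℝ) 1) (hβ : 0 ≤ β)
    (h : shoot (a, β) = 0) : fderiv ℝ shoot (a, β) (0, 1) ≠ 0 := by
  have hd : HasDerivAt (fun b => shoot (a, b)) (fderiv ℝ shoot (a, β) (0, 1)) β :=
    (analyticAt_shoot (p := (a, β)) ha).differentiableAt.hasFDerivAt.comp_hasDerivAt β
      ((hasDerivAt_const β a).prodMk (hasDerivAt_id β))
  have hpos := dirichletFun_pi_pos ha hβ h
  have hslope := (hasDerivWithinAt_iff_tendsto_slope' (notMem_Ioi.2 le_rfl)).1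
    (hd.hasDerivWithinAt (s := Ioi β))
  have hle : Real.pi / 4 / dirichletFun (coeff (a, β)) Real.pi ≤
      fderiv ℝ shoot (a, β) (0, 1) := by
    refine ge_of_tendsto hslope ?_
    filter_upwards [self_mem_nhdsWithin] with b hb
    have hb' : 0 < b - β := sub_pos.2 hb
    rw [slope_def_field, h, sub_zero, div_le_div_iff₀ hpos hb']
    linarith [le_mul_shoot ha hβ (le_of_lt hb) h]
  have : 0 < Real.pi / 4 / dirichletFun (coeff (a, β)) Real.pi := by positivity
  exact (this.trans_le hle).ne'

theorem analyticAt_shootZero {a : ℝ} (ha : a ∈ Ioo (-1 : ℝ) 1) : AnalyticAt ℝ shootZero a := by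
  obtain ⟨h1, h2⟩ := shootZero_spec ha
  have hc : ContDiffAt ℝ (⊤ : WithTop ℕ∞) shoot (a, shootZero a) :=
    (analyticAt_shoot (p := (a, shootZero a)) ha).contDiffAt
  have hinv : (fderiv ℝ shoot (a, shootZero a) ∘L .inr ℝ ℝ ℝ).IsInvertible := by
    refine ⟨ContinuousLinearEquiv.unitsEquivAut ℝ
      (Units.mk0 _ (fderiv_shoot_ne_zero ha h1.1.le h2)), ?_⟩
    ext
    simp
  have hψ := hc.contDiffAt_implicitFunction (by simp) hinv
  have hψ0 := hc.implicitFunction_apply_self (by simp) hinv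
  have hψ1 := hc.eventually_apply_implicitFunction (by simp) hinv
  set ψ := hc.implicitFunction (by simp) hinv
  have hψa : AnalyticAt ℝ ψ a := hψ.analyticAt
  refine hψa.congr ?_
  simp only at hψ0 hψ1
  have e1 : ∀ᶠ x in nhds a, 0 < ψ x :=
    hψa.continuousAt.eventually_const_lt (by rw [hψ0]; exact h1.1)
  filter_upwards [hψ1, e1, isOpen_Ioo.mem_nhds ha] with x hx1 hx2 hx3
  exact (shoot_eq_zero_iff hx3 hx2.le).1 (hx1.trans h2)


/-! ### The monodromy matrix -/

section Monodromy

variable (β : ℝ) (e : Ico (0 : ℝ) 1)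

theorem isSolOn_fundamentalSolution (j : Fin 2) (s : Set ℝ) :
    IsSolOn (potential β e) (fun t => fundamentalSolution β e t 1 j)
      (fun t => fundamentalSolution β e t 0 j) s := fun t _ => by
  have h := (fundamentalSolution_spec β e).2 t
  constructor
  · convert! h 1 j using 1
    simp [J, B, Matrix.mul_apply, Fin.sum_univ_two]
  · convert! h 0 j using 1
    simp [J, B, Matrix.mul_apply, Fin.sum_univ_two]

theorem fundamentalSolution_zero (i j : Fin 2) :
    fundamentalSolution β e 0 i j = if i = j then 1 else 0 := by
  rw [(fundamentalSolution_spec β e).1, Matrix.one_apply]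

theorem fundamentalSolution_det {t : ℝ} (ht : 0 ≤ t) :
    fundamentalSolution β e t 0 0 * fundamentalSolution β e t 1 1 -
      fundamentalSolution β e t 0 1 * fundamentalSolution β e t 1 0 = 1 := by
  have h := (isSolOn_fundamentalSolution β e 1 (Icc 0 t)).wronskian_eq
    (isSolOn_fundamentalSolution β e 0 (Icc 0 t)) (right_mem_Icc.2 ht) (left_mem_Icc.2 ht)
  simp [fundamentalSolution_zero] at h
  linarith

/-- Every solution is the combination of the columns of the fundamental solution given by its
initial values. -/
theorem solution_eq_smul_add_smul {E : Type*} [NormedAddCommGroup E] [NormedSpace ℝ E] {u v : ℝ → E}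
    {T : ℝ} (hu : ContinuousOn u (Icc 0 T)) (hv : ContinuousOn v (Icc 0 T))
    (hd : ∀ t ∈ Ioo 0 T, HasDerivAt u (v t) t ∧ HasDerivAt v ((potential β e t - 1) • u t) t)
    {t : ℝ} (ht : t ∈ Icc 0 T) :
    u t = fundamentalSolution β e t 1 0 • v 0 + fundamentalSolution β e t 1 1 • u 0 ∧
    v t = fundamentalSolution β e t 0 0 • v 0 + fundamentalSolution β e t 0 1 • u 0 := by
  have hsol := fun j t => isSolOn_fundamentalSolution β e j univ t (mem_univ t)
  have key : ∀ j, fundamentalSolution β e t 1 j • v t - fundamentalSolution β e t 0 j • u t =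
      fundamentalSolution β e 0 1 j • v 0 - fundamentalSolution β e 0 0 j • u 0 := fun j => by
    refine eq_of_hasDerivAt_zero (f := fun t => fundamentalSolution β e t 1 j • v t -
      fundamentalSolution β e t 0 j • u t) ?_ (fun s hs => ?_) ht
      (left_mem_Icc.2 (ht.1.trans ht.2))
    · exact (ContinuousOn.smul (fun s _ => (hsol j s).1.continuousAt.continuousWithinAt) hv).sub
        (ContinuousOn.smul (fun s _ => (hsol j s).2.continuousAt.continuousWithinAt) hu)
    · convert! ((hsol j s).1.smul (hd s hs).2).sub ((hsol j s).2.smul (hd s hs).1) using 1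
      module
  have hdet := fundamentalSolution_det β e ht.1
  have k0 := key 0
  have k1 := key 1
  simp only [fundamentalSolution_zero, Fin.isValue, one_ne_zero, zero_ne_one, if_true, if_false,
    one_smul, zero_smul, sub_zero, zero_sub] at k0 k1
  have hu' : u 0 = -(fundamentalSolution β e t 1 0 • v t - fundamentalSolution β e t 0 0 • u t) := by
    rw [k0, neg_neg]
  constructor
  · rw [← k1, hu']
    conv_lhs => rw [← one_smul ℝ (u t), ← hdet]
    module
  · rw [← k1, hu']
    conv_lhs => rw [← one_smul ℝ (v t), ← hdet]
    module

theorem IsSolOn.eq_fundamentalSolution {u v : ℝ → ℝ} {T : ℝ}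
    (h : IsSolOn (potential β e) u v (Icc 0 T)) {t : ℝ} (ht : t ∈ Icc 0 T) :
    u t = fundamentalSolution β e t 1 0 * v 0 + fundamentalSolution β e t 1 1 * u 0 ∧
    v t = fundamentalSolution β e t 0 0 * v 0 + fundamentalSolution β e t 0 1 * u 0 :=
  solution_eq_smul_add_smul β e (fun s hs => (h s hs).1.continuousAt.continuousWithinAt)
    (fun s hs => (h s hs).2.continuousAt.continuousWithinAt)
    (fun s hs => h s (Ioo_subset_Icc_self hs)) ht

/-- Reflection of a solution at `T / 2`. -/
theorem IsSolOn.reflect {q q' u v : ℝ → ℝ} {T : ℝ} (h : IsSolOn q u v (Icc 0 T))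
    (hq : ∀ t ∈ Icc 0 T, q (T - t) = q' t) :
    IsSolOn q' (fun t => u (T - t)) (fun t => -v (T - t)) (Icc 0 T) := fun t ht => by
  have ht' : T - t ∈ Icc 0 T := ⟨by linarith [ht.2], by linarith [ht.1]⟩
  have hr : HasDerivAt (fun t => T - t) (-1) t := by
    simpa using (hasDerivAt_id t).const_sub T
  constructor
  · simpa using! (h _ ht').1.comp t hr
  · simpa [hq t ht] using! ((h _ ht').2.comp t hr).neg

theorem coe_mem_Ioo : (e : ℝ) ∈ Ioo (-1 : ℝ) 1 := ⟨by linarith [e.2.1], e.2.2⟩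

theorem neg_coe_mem_Ioo : -(e : ℝ) ∈ Ioo (-1 : ℝ) 1 := ⟨by linarith [e.2.2], by linarith [e.2.1]⟩

theorem fundamentalSolution_pi_zero_zero :
    fundamentalSolution β e Real.pi 0 0 = shoot (e, β) := by
  have h : IsSolOn (potential β e) (dirichletFun (coeff (e, β))) (dirichletDeriv (coeff (e, β)))
      (Icc 0 Real.pi) := fun t ht => by
    have := isSolOn_dirichletFun (coeff (e, β)) t ht
    rwa [extend_coeff (coe_mem_Ioo e) β ht] at this
  have := (h.eq_fundamentalSolution β e (right_mem_Icc.2 Real.pi_pos.le)).2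
  rw [dirichletFun_zero, dirichletDeriv_zero] at this
  rw [shoot, this]
  ring

theorem fundamentalSolution_pi_one_one :
    fundamentalSolution β e Real.pi 1 1 = shoot (-e, β) := by
  have h : IsSolOn (potential β e) (fun t => dirichletFun (coeff (-e, β)) (Real.pi - t))
      (fun t => -dirichletDeriv (coeff (-e, β)) (Real.pi - t)) (Icc 0 Real.pi) := by
    refine (isSolOn_dirichletFun (coeff (-e, β))).reflect fun t ht => ?_
    rw [extend_coeff (neg_coe_mem_Ioo e) β ⟨by linarith [ht.2], by linarith [ht.1]⟩,
      Real.cos_pi_sub, potential]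
    ring_nf
  obtain ⟨h1, h2⟩ := h.eq_fundamentalSolution β e (right_mem_Icc.2 Real.pi_pos.le)
  simp only [sub_self, sub_zero, dirichletFun_zero, dirichletDeriv_zero] at h1 h2
  have hdet := fundamentalSolution_det β e Real.pi_pos.le
  rw [shoot]
  linear_combination fundamentalSolution β e Real.pi 0 1 * h1 -
    fundamentalSolution β e Real.pi 1 1 * h2 +
    dirichletDeriv (coeff (-e, β)) Real.pi * hdet

theorem potential_two_pi_sub (t : ℝ) : potential β e (2 * Real.pi - t) = potential β e t := by
  rw [potential, potential, Real.cos_two_pi_sub]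

theorem isSolOn_reflect_fundamentalSolution (j : Fin 2) :
    IsSolOn (potential β e) (fun t => fundamentalSolution β e (2 * Real.pi - t) 1 j)
      (fun t => -fundamentalSolution β e (2 * Real.pi - t) 0 j) (Icc 0 (2 * Real.pi)) :=
  (isSolOn_fundamentalSolution β e j _).reflect fun t _ => potential_two_pi_sub β e t

/-- The entries of `γ(2π)` in terms of those of `γ(π)`. -/
theorem fundamentalSolution_two_pi {a b c d : ℝ} (ha : fundamentalSolution β e Real.pi 0 0 = a)
    (hb : fundamentalSolution β e Real.pi 0 1 = b) (hc : fundamentalSolution β e Real.pi 1 0 = c)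
    (hd : fundamentalSolution β e Real.pi 1 1 = d) :
    fundamentalSolution β e (2 * Real.pi) =
      !![a * d + b * c, 2 * (b * d); 2 * (a * c), a * d + b * c] := by
  have hπ : Real.pi ∈ Icc 0 (2 * Real.pi) := ⟨Real.pi_pos.le, by linarith [Real.pi_pos]⟩
  have hdet := fundamentalSolution_det β e Real.pi_pos.le
  have k := fun j =>
    (isSolOn_reflect_fundamentalSolution β e j).eq_fundamentalSolution β e hπ
  obtain ⟨k1, k2⟩ := k 0
  obtain ⟨k3, k4⟩ := k 1
  have e1 : 2 * Real.pi - Real.pi = Real.pi := by ring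
  simp only [e1, sub_zero, ha, hb, hc, hd] at k1 k2 k3 k4 hdet
  ext i j
  fin_cases i <;> fin_cases j <;>
    simp only [Fin.zero_eta, Fin.mk_one, Fin.isValue, Matrix.of_apply, Matrix.cons_val', Matrix.cons_val_zero,
      Matrix.cons_val_one, Matrix.cons_val_fin_one]
  · linear_combination d * k2 - b * k1 -
      fundamentalSolution β e (2 * Real.pi) 0 0 * hdet
  · linear_combination d * k4 - b * k3 -
      fundamentalSolution β e (2 * Real.pi) 0 1 * hdet
  · linear_combination c * k2 - a * k1 -
      fundamentalSolution β e (2 * Real.pi) 1 0 * hdet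
  · linear_combination c * k4 - a * k3 -
      fundamentalSolution β e (2 * Real.pi) 1 1 * hdet

theorem finrank_ker_toLin'_of_apply_eq_zero {M : Matrix (Fin 2) (Fin 2) ℂ} {v : Fin 2 → ℂ}
    (hv : v ≠ 0) (h : ∀ w, M.mulVec w = 0 ↔ ∃ c : ℂ, c • v = w) :
    Module.finrank ℂ (LinearMap.ker (Matrix.toLin' M)) = 1 := by
  have : LinearMap.ker (Matrix.toLin' M) = Submodule.span ℂ {v} := by
    ext w
    rw [LinearMap.mem_ker, Matrix.toLin'_apply, h, Submodule.mem_span_singleton]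
  rw [this, finrank_span_singleton hv]

open Classical in
/-- The nullity of a matrix with the symmetry of `γ(2π)`. -/
theorem nullity_neg_one {a b c d : ℝ} (h : a * d - b * c = 1) :
    nullity (-1) !![a * d + b * c, 2 * (b * d); 2 * (a * c), a * d + b * c] =
      (if a = 0 then 1 else 0) + (if d = 0 then 1 else 0) := by
  have hM : (!![a * d + b * c, 2 * (b * d); 2 * (a * c), a * d + b * c] :
      Matrix (Fin 2) (Fin 2) ℝ).map (algebraMap ℝ ℂ) - (-1 : ℂ) • (1 : Matrix (Fin 2) (Fin 2) ℂ) =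
      !![(2 * a * d : ℂ), 2 * b * d; 2 * a * c, 2 * a * d] := by
    have h' : (a * d - b * c : ℂ) = 1 := by exact_mod_cast h
    ext i j
    fin_cases i <;> fin_cases j <;> simp [mul_assoc] <;> linear_combination -h'
  have hmv : ∀ w : Fin 2 → ℂ, (!![(2 * a * d : ℂ), 2 * b * d; 2 * a * c, 2 * a * d]).mulVec w = 0 ↔
      (2 * a * d * w 0 + 2 * b * d * w 1 : ℂ) = 0 ∧ (2 * a * c * w 0 + 2 * a * d * w 1 : ℂ) = 0 := by
    intro w
    rw [funext_iff, Fin.forall_fin_two]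
    simp [Matrix.mulVec, dotProduct, Fin.sum_univ_two]
  unfold nullity
  rw [hM]
  by_cases ha : a = 0 <;> by_cases hd : d = 0 <;> simp only [ha, hd, if_true, if_false]
  · have h0 : !![(2 * a * d : ℂ), 2 * b * d; 2 * a * c, 2 * a * d] = 0 := by
      ext i j
      fin_cases i <;> fin_cases j <;> simp [ha, hd]
    rw [h0, map_zero, LinearMap.ker_zero, finrank_top]
    simp
  · have hb : b ≠ 0 := by rintro rfl; simp [ha] at h
    subst ha
    refine finrank_ker_toLin'_of_apply_eq_zero (v := ![1, 0]) (by simp) fun w => ?_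
    rw [hmv]
    constructor
    · rintro ⟨h1, -⟩
      have : w 1 = 0 := by simpa [hb, hd] using h1
      exact ⟨w 0, by ext i; fin_cases i <;> simp [this]⟩
    · rintro ⟨k, rfl⟩
      simp
  · have hc : c ≠ 0 := by rintro rfl; simp [hd] at h
    subst hd
    refine finrank_ker_toLin'_of_apply_eq_zero (v := ![0, 1]) (by simp) fun w => ?_
    rw [hmv]
    constructor
    · rintro ⟨-, h1⟩
      have : w 0 = 0 := by simpa [hc, ha] using h1
      exact ⟨w 1, by ext i; fin_cases i <;> simp [this]⟩
    · rintro ⟨k, rfl⟩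
      simp
  · rw [Nat.add_zero, Submodule.finrank_eq_zero, Submodule.eq_bot_iff]
    intro w hw
    rw [LinearMap.mem_ker, Matrix.toLin'_apply, hmv] at hw
    obtain ⟨h1, h2⟩ := hw
    have h' : (a * d - b * c : ℂ) = 1 := by exact_mod_cast h
    have ha' : (a : ℂ) ≠ 0 := by exact_mod_cast ha
    have hd' : (d : ℂ) ≠ 0 := by exact_mod_cast hd
    have h1' : (a * w 0 + b * w 1 : ℂ) = 0 := by
      refine (mul_eq_zero.1 (?_ : (2 * d : ℂ) * _ = 0)).resolve_left (by simpa using hd')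
      linear_combination h1
    have h2' : (c * w 0 + d * w 1 : ℂ) = 0 := by
      refine (mul_eq_zero.1 (?_ : (2 * a : ℂ) * _ = 0)).resolve_left (by simpa using ha')
      linear_combination h2
    ext i
    fin_cases i
    · simp only [Fin.zero_eta, Pi.zero_apply]
      linear_combination d * h1' - b * h2' - w 0 * h'
    · simp only [Fin.mk_one, Pi.zero_apply]
      linear_combination a * h2' - c * h1' - w 1 * h'

open Classical in
theorem nullity_fundamentalSolution_two_pi :
    nullity (-1) (fundamentalSolution β e (2 * Real.pi)) =
      (if shoot (e, β) = 0 then 1 else 0) + (if shoot (-e, β) = 0 then 1 else 0) := by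
  rw [fundamentalSolution_two_pi β e (fundamentalSolution_pi_zero_zero β e) rfl rfl
    (fundamentalSolution_pi_one_one β e)]
  refine nullity_neg_one ?_
  rw [← fundamentalSolution_pi_zero_zero, ← fundamentalSolution_pi_one_one]
  exact fundamentalSolution_det β e Real.pi_pos.le

end Monodromy

/-! ### The two degeneracy curves -/

open Classical in
theorem nullity_eq_shootZero (e : Ico (0 : ℝ) 1) {β : ℝ} (hβ : 0 ≤ β) :
    nullity (-1) (fundamentalSolution β e (2 * Real.pi)) =
      (if β = shootZero e then 1 else 0) + (if β = shootZero (-e) then 1 else 0) := by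
  simp only [nullity_fundamentalSolution_two_pi, shoot_eq_zero_iff (coe_mem_Ioo e) hβ,
    shoot_eq_zero_iff (neg_coe_mem_Ioo e) hβ]

theorem areDegeneracyCurves_shootZero :
    AreDegeneracyCurves (-1) shootZero (fun e => shootZero (-e)) where
  analytic₁ e he := (analyticAt_shootZero (coe_mem_Ioo ⟨e, he⟩)).analyticWithinAt
  analytic₂ e he := ((analyticAt_shootZero (neg_coe_mem_Ioo ⟨e, he⟩)).comp
    (f := fun e : ℝ => -e) analyticAt_id.neg).analyticWithinAt
  mem₁ e he := (shootZero_spec (coe_mem_Ioo ⟨e, he⟩)).1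
  mem₂ e he := (shootZero_spec (neg_coe_mem_Ioo ⟨e, he⟩)).1
  nullity_eq e _ hβ := nullity_eq_shootZero e hβ.1

/-- Two analytic enumerations of the degeneracy points agree up to the numbering. -/
theorem AreDegeneracyCurves.eq_shootZero {β₁ β₂ : ℝ → ℝ} (h : AreDegeneracyCurves (-1) β₁ β₂) :
    (∀ e ∈ Ico (0 : ℝ) 1, β₁ e = shootZero e ∧ β₂ e = shootZero (-e)) ∨
    (∀ e ∈ Ico (0 : ℝ) 1, β₁ e = shootZero (-e) ∧ β₂ e = shootZero e) := by
  have hpt : ∀ e ∈ Ico (0 : ℝ) 1, (β₁ e = shootZero e ∧ β₂ e = shootZero (-e)) ∨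
      (β₁ e = shootZero (-e) ∧ β₂ e = shootZero e) := fun e he => by
    have k : ∀ β ∈ Icc (0 : ℝ) 1, _ := fun β hβ =>
      (h.nullity_eq ⟨e, he⟩ β hβ).symm.trans (nullity_eq_shootZero ⟨e, he⟩ hβ.1)
    have k1 := k _ (Ioo_subset_Icc_self (h.mem₁ e he))
    have k2 := k _ (Ioo_subset_Icc_self (h.mem₂ e he))
    simp only [if_true] at k1 k2
    grind
  have hA := areDegeneracyCurves_shootZero
  have hprod := AnalyticOnNhd.eq_zero_or_eq_zero_of_smul_eq_zero (𝕜 := ℝ) (U := Ioo (0 : ℝ) 1)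
    (f := fun e => β₁ e - shootZero e) (g := fun e => β₁ e - shootZero (-e))
    (isOpen_Ioo.analyticOn_iff_analyticOnNhd.1 ((h.analytic₁.sub hA.analytic₁).mono
      Ioo_subset_Ico_self))
    (isOpen_Ioo.analyticOn_iff_analyticOnNhd.1 ((h.analytic₁.sub hA.analytic₂).mono
      Ioo_subset_Ico_self))
    (fun e he => by
      rcases hpt e (Ioo_subset_Ico_self he) with h1 | h1 <;> simp [h1.1])
    isPreconnected_Ioo
  refine hprod.imp (fun h0 e he => ?_) (fun h0 e he => ?_) <;>
  · rcases he.1.eq_or_lt with rfl | hpos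
    · simpa using hpt 0 he
    · have h1 := sub_eq_zero.1 (h0 e ⟨hpos, he.2⟩)
      rcases hpt e he with h2 | h2
      · grind
      · grind


/-! ### The operator and the symmetry -/

theorem two_pi_sub_mem {t : ℝ} (ht : t ∈ Icc 0 (2 * Real.pi)) :
    2 * Real.pi - t ∈ Icc 0 (2 * Real.pi) := ⟨by linarith [ht.2], by linarith [ht.1]⟩

theorem integral_reflect (f : ℝ → ℂ) (t : ℝ) :
    ∫ s in (0 : ℝ)..t, f (2 * Real.pi - s) = ∫ s in (2 * Real.pi - t)..(2 * Real.pi), f s := by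
  rw [intervalIntegral.integral_comp_sub_left, sub_zero]

theorem eq_add_integral_reflect {u v : ℝ → ℂ} (hv : Integrable v intervalMeasure)
    (h : ∀ t ∈ Icc 0 (2 * Real.pi), u t = u 0 + ∫ s in (0 : ℝ)..t, v s) {t : ℝ}
    (ht : t ∈ Icc 0 (2 * Real.pi)) :
    u (2 * Real.pi - t) = u (2 * Real.pi) - ∫ s in (0 : ℝ)..t, v (2 * Real.pi - s) := by
  have hT : 2 * Real.pi ∈ Icc 0 (2 * Real.pi) := right_mem_Icc.2 Real.two_pi_pos.le
  have h1 := h _ (two_pi_sub_mem ht)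
  have h2 := h _ hT
  have h3 := intervalIntegral.integral_add_adjacent_intervals
    (intervalIntegrable_of_integrable hv (two_pi_sub_mem ht))
    ((intervalIntegrable_of_integrable hv (two_pi_sub_mem ht)).symm.trans
      (intervalIntegrable_of_integrable hv hT))
  rw [integral_reflect, h1, h2, ← h3]
  ring

theorem ae_reflect {p : ℝ → Prop} (h : ∀ᵐ t ∂intervalMeasure, p t) :
    ∀ᵐ t ∂intervalMeasure, p (2 * Real.pi - t) :=
  measurePreserving_reflect.quasiMeasurePreserving.ae h

theorem IsW22.reflect {y : L2} {u v : ℝ → ℂ} {w : L2} (h : IsW22 y u v w) :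
    IsW22 (reflection y) (fun t => -u (2 * Real.pi - t)) (fun t => v (2 * Real.pi - t))
      (reflection w) where
  ae_eq := by
    filter_upwards [coeFn_reflection y, ae_reflect h.ae_eq] with t h1 h2
    rw [h1, h2]
  eq_integral t ht := by
    rw [eq_add_integral_reflect h.integrable_deriv h.eq_integral ht, sub_zero]
    ring
  deriv_eq_integral t ht := by
    rw [eq_add_integral_reflect (L2_integrable w) h.deriv_eq_integral ht, sub_zero,
      integral_congr (coeFn_reflection w) ht, intervalIntegral.integral_neg]
    ring

theorem reflection_mem_Dbar {y : L2} (hy : y ∈ Dbar (-1)) : reflection y ∈ Dbar (-1) := by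
  obtain ⟨u, v, w, h, hu, hv⟩ := hy
  exact ⟨_, _, _, h.reflect, by simp [hu], by simp [hv]⟩

theorem reflection_reflection (y : L2) : reflection (reflection y) = y := by
  refine Lp.ext ?_
  filter_upwards [coeFn_reflection (reflection y), ae_reflect (coeFn_reflection y)] with t h1 h2
  rw [h1, h2, neg_neg, sub_sub_cancel]

theorem secondDeriv_eq {ω : ℂ} {y : Dbar ω} {u v : ℝ → ℂ} {w : L2} (h : IsW22 y u v w) :
    secondDeriv ω y = w := by
  obtain ⟨u', v', h'⟩ := (Dbar.exists_second y).choose_spec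
  exact h'.second_unique h

theorem slOperator_apply {β : ℝ} {e : Ico (0 : ℝ) 1} {ω : ℂ} (y : (slOperator β e ω).domain)
    {u v : ℝ → ℂ} {w : L2} (h : IsW22 y u v w) :
    slOperator β e ω y = -w - y + potentialMul β e y := by
  rw [← secondDeriv_eq (y := y) h]
  rfl

theorem coeFn_potentialMul (β : ℝ) (e : Ico (0 : ℝ) 1) (y : L2) :
    potentialMul β e y =ᵐ[intervalMeasure] fun t => (potential β e t : ℂ) * y t :=
  (potential_mul_memLp β e y).coeFn_toLp

theorem potentialMul_reflection (β : ℝ) (e : Ico (0 : ℝ) 1) (y : L2) :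
    potentialMul β e (reflection y) = reflection (potentialMul β e y) := by
  refine Lp.ext ?_
  filter_upwards [coeFn_potentialMul β e (reflection y), coeFn_reflection y,
    coeFn_reflection (potentialMul β e y), ae_reflect (coeFn_potentialMul β e y)] with t h1 h2 h3 h4
  rw [h1, h2, h3, h4, potential_two_pi_sub, mul_neg]

theorem slOperator_reflection (β : ℝ) (e : Ico (0 : ℝ) 1) (y : (slOperator β e (-1)).domain) :
    ∃ h : reflection y ∈ (slOperator β e (-1)).domain,
      slOperator β e (-1) ⟨reflection y, h⟩ = reflection (slOperator β e (-1) y) := by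
  have hr : reflection y ∈ (slOperator β e (-1)).domain := reflection_mem_Dbar y.2
  obtain ⟨u, v, w, h, -⟩ : (y : L2) ∈ Dbar (-1) := y.2
  refine ⟨hr, ?_⟩
  rw [slOperator_apply ⟨_, hr⟩ h.reflect, slOperator_apply y h, potentialMul_reflection,
    map_add, map_sub, map_neg]

theorem mem_oddSubspace {z : L2} : z ∈ oddSubspace ↔ z ∈ Dbar (-1) ∧ reflection z = -z := by
  rw [oddSubspace, Submodule.mem_inf, LinearMap.mem_ker, LinearMap.add_apply, LinearMap.id_apply,
    ← eq_neg_iff_add_eq_zero]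

theorem mem_evenSubspace {z : L2} : z ∈ evenSubspace ↔ z ∈ Dbar (-1) ∧ reflection z = z := by
  rw [evenSubspace, Submodule.mem_inf, LinearMap.mem_ker, LinearMap.sub_apply, LinearMap.id_apply,
    sub_eq_zero]

theorem odd_sup_even : oddSubspace ⊔ evenSubspace = Dbar (-1) := by
  refine le_antisymm (sup_le inf_le_left inf_le_left) fun z hz => ?_
  have hr := reflection_mem_Dbar hz
  refine Submodule.mem_sup.2 ⟨(1 / 2 : ℂ) • (z - reflection z), mem_oddSubspace.2 ⟨?_, ?_⟩,
    (1 / 2 : ℂ) • (z + reflection z), mem_evenSubspace.2 ⟨?_, ?_⟩, ?_⟩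
  · exact Submodule.smul_mem _ _ (Submodule.sub_mem _ hz hr)
  · rw [map_smul, map_sub, reflection_reflection, ← smul_neg, neg_sub]
  · exact Submodule.smul_mem _ _ (Submodule.add_mem _ hz hr)
  · rw [map_smul, map_add, reflection_reflection, add_comm]
  · module

theorem odd_inf_even : oddSubspace ⊓ evenSubspace = ⊥ := by
  refine (Submodule.eq_bot_iff _).2 fun z hz => ?_
  have h1 := (mem_oddSubspace.1 hz.1).2
  have h2 := (mem_evenSubspace.1 hz.2).2
  have h3 : (2 : ℂ) • z = 0 := by
    rw [two_smul]
    nth_rewrite 1 [← h2]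
    rw [h1, neg_add_cancel]
  exact (smul_eq_zero.1 h3).resolve_left two_ne_zero

theorem isDegenerate_domRestrict_iff {β : ℝ} {e : Ico (0 : ℝ) 1} {S : Submodule ℂ L2}
    (hS : S ≤ Dbar (-1)) :
    IsDegenerate ((slOperator β e (-1)).domRestrict S) ↔
      ∃ z ∈ S, z ≠ 0 ∧ ∃ u v w, IsW22 z u v w ∧ -w - z + potentialMul β e z = 0 ∧
        u (2 * Real.pi) = -u 0 ∧ v (2 * Real.pi) = -v 0 := by
  rw [IsDegenerate, ne_eq, Submodule.eq_bot_iff]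
  push Not
  constructor
  · rintro ⟨⟨z, hz⟩, hz0, hne⟩
    obtain ⟨u, v, w, h, hu, hv⟩ : z ∈ Dbar (-1) := hS hz.1
    refine ⟨z, hz.1, fun h0 => hne (Subtype.ext h0), u, v, w, h, ?_, by simpa using hu,
      by simpa using hv⟩
    rw [← slOperator_apply (⟨z, hz.2⟩ : (slOperator β e (-1)).domain) h]
    exact hz0
  · rintro ⟨z, hz, hne, u, v, w, h, h0, -⟩
    refine ⟨⟨z, hz, hS hz⟩, ?_, fun h0 => hne (congrArg Subtype.val h0)⟩
    rw [← slOperator_apply (⟨z, hS hz⟩ : (slOperator β e (-1)).domain) h] at h0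
    exact h0

section Kernel

variable {β : ℝ} {e : Ico (0 : ℝ) 1}

theorem hasDerivAt_of_eq_integral {u v : ℝ → ℂ} (hv : ContinuousOn v (Icc 0 (2 * Real.pi)))
    (h : ∀ t ∈ Icc 0 (2 * Real.pi), u t = u 0 + ∫ s in (0 : ℝ)..t, v s) {t : ℝ}
    (ht : t ∈ Ioo 0 (2 * Real.pi)) : HasDerivAt u (v t) t := by
  have ht' := Ioo_subset_Icc_self ht
  have h1 : HasDerivAt (fun t => ∫ s in (0 : ℝ)..t, v s) (v t) t :=
    intervalIntegral.integral_hasDerivAt_right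
      (intervalIntegrable_of_integrable hv.integrableOn_Icc ht')
      ((hv.mono Ioo_subset_Icc_self).stronglyMeasurableAtFilter isOpen_Ioo t ht)
      (hv.continuousAt (Icc_mem_nhds ht.1 ht.2))
  refine (h1.const_add (u 0)).congr_of_eventuallyEq ?_
  filter_upwards [Icc_mem_nhds ht.1 ht.2] with s hs using h s hs

/-- Elements of the kernel are combinations of the columns of the fundamental solution. -/
theorem IsW22.eq_fundamentalSolution {z : L2} {u v : ℝ → ℂ} {w : L2} (h : IsW22 z u v w)
    (h0 : -w - z + potentialMul β e z = 0) {t : ℝ} (ht : t ∈ Icc 0 (2 * Real.pi)) :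
    u t = fundamentalSolution β e t 1 0 * v 0 + fundamentalSolution β e t 1 1 * u 0 ∧
    v t = fundamentalSolution β e t 0 0 * v 0 + fundamentalSolution β e t 0 1 * u 0 := by
  have hw : w = potentialMul β e z - z := by
    rw [eq_comm, ← sub_eq_zero, ← h0]
    abel
  have hae : w =ᵐ[intervalMeasure] fun t => (potential β e t - 1) • u t := by
    rw [hw]
    filter_upwards [Lp.coeFn_sub (potentialMul β e z) z, coeFn_potentialMul β e z, h.ae_eq]
      with t h1 h2 h3
    rw [h1, Pi.sub_apply, h2, h3, Complex.real_smul]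
    push_cast
    ring
  have hq : Continuous (potential β e) := (potential_contDiff β e (n := 0)).continuous
  have hc : ContinuousOn (fun t => (potential β e t - 1) • u t) (Icc 0 (2 * Real.pi)) :=
    (hq.sub continuous_const).continuousOn.smul h.continuousOn
  have hv : ∀ t ∈ Icc 0 (2 * Real.pi),
      v t = v 0 + ∫ s in (0 : ℝ)..t, (potential β e s - 1) • u s := fun t ht => by
    rw [← integral_congr hae ht]
    exact h.deriv_eq_integral t ht
  have := solution_eq_smul_add_smul β e h.continuousOn h.continuousOn_deriv (fun t ht =>
    ⟨hasDerivAt_of_eq_integral h.continuousOn_deriv h.eq_integral ht,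
      hasDerivAt_of_eq_integral hc hv ht⟩) ht
  simpa only [Complex.real_smul] using this

theorem IsW22.eq_zero_of_initial {z : L2} {u v : ℝ → ℂ} {w : L2} (h : IsW22 z u v w)
    (h0 : -w - z + potentialMul β e z = 0) (hu : u 0 = 0) (hv : v 0 = 0) : z = 0 := by
  refine Lp.ext ((h.ae_eq.trans ?_).trans (Lp.coeFn_zero ℂ 2 intervalMeasure).symm)
  refine (ae_restrict_iff' measurableSet_Icc).2 (ae_of_all _ fun t ht => ?_)
  rw [(h.eq_fundamentalSolution h0 ht).1, hu, hv]
  simp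

theorem IsW22.reflection_eq_smul {z : L2} {u v : ℝ → ℂ} {w : L2} (h : IsW22 z u v w)
    (h0 : -w - z + potentialMul β e z = 0) {ε : ℂ} (hu : -u (2 * Real.pi) = ε * u 0)
    (hv : v (2 * Real.pi) = ε * v 0) : reflection z = ε • z := by
  have h1 := (h.reflect.add (h.smul (-ε))).eq_zero_of_initial (β := β) (e := e) ?_
    (by simp [hu]) (by simp [hv])
  · rwa [neg_smul, ← sub_eq_add_neg, sub_eq_zero] at h1
  · have h2 := congrArg reflection h0
    rw [map_add, map_sub, map_neg, map_zero, ← potentialMul_reflection] at h2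
    rw [map_add, map_smul]
    calc _ = (-reflection w - reflection z + potentialMul β e (reflection z)) -
          ε • (-w - z + potentialMul β e z) := by module
      _ = 0 := by rw [h2, h0, smul_zero, sub_zero]

theorem IsW22.values_of_reflection_eq_smul {z : L2} {u v : ℝ → ℂ} {w : L2} (h : IsW22 z u v w)
    {ε : ℂ} (hε : reflection z = ε • z) :
    -u (2 * Real.pi) = ε * u 0 ∧ v (2 * Real.pi) = ε * v 0 := by
  have h0π : (0 : ℝ) ∈ Icc 0 (2 * Real.pi) := left_mem_Icc.2 Real.two_pi_pos.le
  have h1 := h.reflect.add (h.smul (-ε))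
  rw [hε, neg_smul, add_neg_cancel] at h1
  have hu := h1.eq_zero.1 0 h0π
  have hv := h1.eq_zero.2.1 0 h0π
  simp only [Pi.add_apply, Pi.smul_apply, smul_eq_mul, sub_zero] at hu hv
  exact ⟨by linear_combination hu, by linear_combination hv⟩

/-- The columns of the fundamental solution as elements of the Sobolev space. -/
theorem exists_isW22_fundamentalSolution (β : ℝ) (e : Ico (0 : ℝ) 1) (j : Fin 2) :
    ∃ z w : L2, IsW22 z (fun t => (fundamentalSolution β e t 1 j : ℂ))
      (fun t => (fundamentalSolution β e t 0 j : ℂ)) w ∧ -w - z + potentialMul β e z = 0 := by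
  have hsol := fun t => isSolOn_fundamentalSolution β e j univ t (mem_univ t)
  have hu : Continuous fun t => (fundamentalSolution β e t 1 j : ℂ) :=
    continuous_iff_continuousAt.2 fun t => (hsol t).1.ofReal_comp.continuousAt
  have hv : Continuous fun t => (fundamentalSolution β e t 0 j : ℂ) :=
    continuous_iff_continuousAt.2 fun t => (hsol t).2.ofReal_comp.continuousAt
  have hmem : MemLp (fun t => (fundamentalSolution β e t 1 j : ℂ)) 2 intervalMeasure := by
    obtain ⟨C, hC⟩ := isCompact_Icc.exists_bound_of_continuousOn (s := Icc 0 (2 * Real.pi))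
      hu.continuousOn
    exact MemLp.of_bound hu.aestronglyMeasurable C
      ((ae_restrict_iff' measurableSet_Icc).2 (ae_of_all _ hC))
  set z : L2 := hmem.toLp
  have hz := hmem.coeFn_toLp
  have hw : ⇑(potentialMul β e z - z) =ᵐ[intervalMeasure] fun t =>
      (((potential β e t - 1) * fundamentalSolution β e t 1 j : ℝ) : ℂ) := by
    filter_upwards [Lp.coeFn_sub (potentialMul β e z) z, coeFn_potentialMul β e z, hz]
      with t h1 h2 h3
    rw [h1, Pi.sub_apply, h2, h3]
    push_cast
    ring
  refine ⟨z, potentialMul β e z - z, ⟨hz, fun t ht => ?_, fun t ht => ?_⟩, by abel⟩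
  · rw [intervalIntegral.integral_eq_sub_of_hasDerivAt
      (fun t _ => (hsol t).1.ofReal_comp) (hv.intervalIntegrable _ _)]
    ring
  · have hq : Continuous (potential β e) := (potential_contDiff β e (n := 0)).continuous
    have hc : Continuous fun t =>
        (((potential β e t - 1) * fundamentalSolution β e t 1 j : ℝ) : ℂ) := by
      push_cast
      fun_prop
    rw [integral_congr hw ht, intervalIntegral.integral_eq_sub_of_hasDerivAt
      (fun t _ => (hsol t).2.ofReal_comp) (hc.intervalIntegrable _ _)]
    ring

theorem isDegenerate_odd_iff :
    IsDegenerate ((slOperator β e (-1)).domRestrict oddSubspace) ↔ shoot (e, β) = 0 := by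
  rw [isDegenerate_domRestrict_iff (S := oddSubspace) inf_le_left, ← fundamentalSolution_pi_zero_zero]
  have hdet := fundamentalSolution_det β e Real.pi_pos.le
  have hM := fundamentalSolution_two_pi β e rfl rfl rfl rfl
  set a := fundamentalSolution β e Real.pi 0 0
  set b := fundamentalSolution β e Real.pi 0 1
  set c := fundamentalSolution β e Real.pi 1 0
  set d := fundamentalSolution β e Real.pi 1 1
  constructor
  · rintro ⟨z, hz, hne, u, v, w, h, h0, hu, hv⟩
    have hs := h.values_of_reflection_eq_smul (ε := -1)
      (by rw [(mem_oddSubspace.1 hz).2, neg_one_smul])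
    have hu0 : u 0 = 0 := by linear_combination (hu + hs.1) / 2
    have hv0 : v 0 ≠ 0 := fun hv0 => hne (h.eq_zero_of_initial h0 hu0 hv0)
    obtain ⟨k1, k2⟩ := h.eq_fundamentalSolution h0 (right_mem_Icc.2 Real.two_pi_pos.le)
    rw [hu, hu0, hM] at k1
    rw [hv, hu0, hM] at k2
    simp only [Matrix.of_apply, Matrix.cons_val', Matrix.cons_val_zero, Matrix.cons_val_one,
      Matrix.cons_val_fin_one, mul_zero, add_zero, neg_zero] at k1 k2
    have l1 : 2 * (a * c) = 0 := by
      exact_mod_cast (mul_eq_zero.1 k1.symm).resolve_right hv0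
    have l2 : a * d + b * c = -1 := by
      exact_mod_cast mul_right_cancel₀ hv0 (k2.symm.trans (neg_one_mul _).symm)
    linear_combination a * (l2 + hdet) / 2 - b * l1 / 2 - a * hdet
  · intro h1
    obtain ⟨z, w, h, h0⟩ := exists_isW22_fundamentalSolution β e 0
    have hu : fundamentalSolution β e (2 * Real.pi) 1 0 =
        -fundamentalSolution β e 0 1 0 := by
      rw [hM, fundamentalSolution_zero]
      simp [h1] at hdet ⊢
    have hv : fundamentalSolution β e (2 * Real.pi) 0 0 =
        -fundamentalSolution β e 0 0 0 := by
      rw [hM, fundamentalSolution_zero]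
      simp [h1] at hdet ⊢
      linarith
    refine ⟨z, mem_oddSubspace.2 ⟨⟨_, _, w, h, by simp [hu], by simp [hv]⟩, ?_⟩, ?_, _, _, w, h, h0,
      by simp [hu], by simp [hv]⟩
    · simpa using h.reflection_eq_smul h0 (ε := -1) (by simp [hu, fundamentalSolution_zero])
        (by simp [hv, fundamentalSolution_zero])
    · rintro rfl
      have := h.eq_zero.2.1 0 (left_mem_Icc.2 Real.two_pi_pos.le)
      simp [fundamentalSolution_zero] at this

theorem isDegenerate_even_iff :
    IsDegenerate ((slOperator β e (-1)).domRestrict evenSubspace) ↔ shoot (-e, β) = 0 := by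
  rw [isDegenerate_domRestrict_iff (S := evenSubspace) inf_le_left, ← fundamentalSolution_pi_one_one]
  have hdet := fundamentalSolution_det β e Real.pi_pos.le
  have hM := fundamentalSolution_two_pi β e rfl rfl rfl rfl
  set a := fundamentalSolution β e Real.pi 0 0
  set b := fundamentalSolution β e Real.pi 0 1
  set c := fundamentalSolution β e Real.pi 1 0
  set d := fundamentalSolution β e Real.pi 1 1
  constructor
  · rintro ⟨z, hz, hne, u, v, w, h, h0, hu, hv⟩
    have hs := h.values_of_reflection_eq_smul (ε := 1)
      (by rw [(mem_evenSubspace.1 hz).2, one_smul])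
    have hv0 : v 0 = 0 := by linear_combination (hv - hs.2) / 2
    have hu0 : u 0 ≠ 0 := fun hu0 => hne (h.eq_zero_of_initial h0 hu0 hv0)
    obtain ⟨k1, k2⟩ := h.eq_fundamentalSolution h0 (right_mem_Icc.2 Real.two_pi_pos.le)
    rw [hu, hv0, hM] at k1
    rw [hv, hv0, hM] at k2
    simp only [Matrix.of_apply, Matrix.cons_val', Matrix.cons_val_zero, Matrix.cons_val_one,
      Matrix.cons_val_fin_one, mul_zero, zero_add, neg_zero] at k1 k2
    have l1 : 2 * (b * d) = 0 := by
      exact_mod_cast (mul_eq_zero.1 k2.symm).resolve_right hu0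
    have l2 : a * d + b * c = -1 := by
      exact_mod_cast mul_right_cancel₀ hu0 (k1.symm.trans (neg_one_mul _).symm)
    linear_combination d * (l2 + hdet) / 2 - c * l1 / 2 - d * hdet
  · intro h1
    obtain ⟨z, w, h, h0⟩ := exists_isW22_fundamentalSolution β e 1
    have hu : fundamentalSolution β e (2 * Real.pi) 1 1 =
        -fundamentalSolution β e 0 1 1 := by
      rw [hM, fundamentalSolution_zero]
      simp [h1] at hdet ⊢
      linarith
    have hv : fundamentalSolution β e (2 * Real.pi) 0 1 =
        -fundamentalSolution β e 0 0 1 := by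
      rw [hM, fundamentalSolution_zero]
      simp [h1] at hdet ⊢
    refine ⟨z, mem_evenSubspace.2 ⟨⟨_, _, w, h, by simp [hu], by simp [hv]⟩, ?_⟩, ?_, _, _, w, h, h0,
      by simp [hu], by simp [hv]⟩
    · simpa using h.reflection_eq_smul h0 (ε := 1) (by simp [hu, fundamentalSolution_zero])
        (by simp [hv, fundamentalSolution_zero])
    · rintro rfl
      have := h.eq_zero.1 0 (left_mem_Icc.2 Real.two_pi_pos.le)
      simp [fundamentalSolution_zero] at this

end Kernel

end SturmLiouville

end

open SturmLiouville

theorem SturmLiouville.isDegeneracyCurveOn_oddSubspace {b : ℝ → ℝ}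
    (hb : ∀ e ∈ Ico (0 : ℝ) 1, b e = shootZero e) : IsDegeneracyCurveOn oddSubspace b :=
  fun e β hβ => by
    rw [isDegenerate_odd_iff, shoot_eq_zero_iff (coe_mem_Ioo e) hβ.1, hb e e.2]

theorem SturmLiouville.isDegeneracyCurveOn_evenSubspace {b : ℝ → ℝ}
    (hb : ∀ e ∈ Ico (0 : ℝ) 1, b e = shootZero (-e)) : IsDegeneracyCurveOn evenSubspace b :=
  fun e β hβ => by
    rw [isDegenerate_even_iff, shoot_eq_zero_iff (neg_coe_mem_Ioo e) hβ.1, hb e e.2]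

theorem proposition2p5 :
    -- the symmetry commutes with the operator
    (∀ (β : ℝ) (e : Ico (0 : ℝ) 1) (y : (slOperator β e (-1)).domain),
      ∃ h : reflection y ∈ (slOperator β e (-1)).domain,
        slOperator β e (-1) ⟨reflection y, h⟩ = reflection (slOperator β e (-1) y)) ∧
    -- the domain is the direct sum of the odd and the even subspace
    (oddSubspace ⊔ evenSubspace = Dbar (-1) ∧ oddSubspace ⊓ evenSubspace = ⊥) ∧
    -- the two curves exist and can be numbered by the two subspaces
    (∃ β₁ β₂ : ℝ → ℝ, AreDegeneracyCurves (-1) β₁ β₂ ∧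
      IsDegeneracyCurveOn oddSubspace β₁ ∧ IsDegeneracyCurveOn evenSubspace β₂) ∧
    -- and any choice of the two analytic curves is this one, up to the numbering
    (∀ β₁ β₂ : ℝ → ℝ, AreDegeneracyCurves (-1) β₁ β₂ →
      (IsDegeneracyCurveOn oddSubspace β₁ ∧ IsDegeneracyCurveOn evenSubspace β₂) ∨
      (IsDegeneracyCurveOn evenSubspace β₁ ∧ IsDegeneracyCurveOn oddSubspace β₂)) := by
  refine ⟨slOperator_reflection, ⟨odd_sup_even, odd_inf_even⟩,
    ⟨shootZero, fun e => shootZero (-e), areDegeneracyCurves_shootZero,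
      isDegeneracyCurveOn_oddSubspace fun _ _ => rfl,
      isDegeneracyCurveOn_evenSubspace fun _ _ => rfl⟩, fun β₁ β₂ h => ?_⟩
  refine h.eq_shootZero.imp (fun h => ?_) (fun h => ?_)
  · exact ⟨isDegeneracyCurveOn_oddSubspace fun e he => (h e he).1,
      isDegeneracyCurveOn_evenSubspace fun e he => (h e he).2⟩
  · exact ⟨isDegeneracyCurveOn_evenSubspace fun e he => (h e he).1,
      isDegeneracyCurveOn_oddSubspace fun e he => (h e he).2⟩
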